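/- **Setting.** Vertices are $0,\dots,n-1$. Threads share a parent array $P$ (the label of a vertex is the root $r=P[r]$ reached from it by parent pointers) and, for the lock version, one lock per vertex. Every access to shared memory (a read, a write, a compare-and-swap CAS, taking or releasing a lock) is one atomic step; steps of different threads are interleaved arbitrarily; a thread waits at a lock that is held. A variant is given by a union rule (UF-Rem-CAS or UF-Rem-Lock), a find rule $\mathsf{Compress}\in\{$FindNaive, FindAtomicSplit, FindAtomicHalve, FindCompress$\}$ and a splice rule in $\{$SplitAtomicOne, HalveAtomicOne, SpliceAtomic$\}$; only the combination of FindCompress with SpliceAtomic is excluded. *Union$(u,v)$.* Put $r_u=u$, $r_v=v$. While $P[r_u]\ne P[r_v]$ (exchanging $r_u,r_v$ so that the value read for $r_u$ is the larger one): - if $r_u=P[r_u]$, try to link. UF-Rem-CAS: perform $\mathrm{CAS}(\&P[r_u],r_u,P[r_v])$; on success run Compress$(u)$, Compress$(v)$ (unless the find rule is FindNaive) and return True; on failure splice as below. UF-Rem-Lock: lock $r_u$, read $p_v=P[r_v]$, and if still $r_u=P[r_u]$ and $r_u>p_v$ set $P[r_u]=p_v$; unlock; return True if $P[r_u]$ was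 written, else continue the loop; - otherwise $r_u$ becomes the vertex returned by the splice rule. After the loop return False (UF-Rem-Lock first runs Compress$(u)$, Compress$(v)$ unless the find rule is FindNaive). *Splice rules.* SplitAtomicOne and HalveAtomicOne read $v=P[r_u]$, $w=P[v]$, perform $\mathrm{CAS}(\&P[r_u],v,w)$ if $v\neq w$, and return $v$, respectively $w$. SpliceAtomic reads $p_u=P[r_u]$, $p_v=P[r_v]$, performs $\mathrm{CAS}(\&P[r_u],p_u,p_v)$ if $p_v<p_u$, and returns $p_u$. *Find$(u)$* runs the chosen find rule. FindNaive follows parents to a root and returns it. FindAtomicSplit and FindAtomicHalve repeatedly read $v=P[u]$, $w=P[v]$; if $v=w$ they return $v$, else they perform $\mathrm{CAS}(\&P[u],v,w)$ and set $u\leftarrow v$, respectively $u\leftarrow P[u]$. FindCompress follows parents to a root $r$; if $r$ is not $u$ itself then, while $j=P[u]>r$, it replaces $P[u]$ by $\min(P[u],r)$ atomically and sets $u\leftarrow j$; it returns $r$. **Theorem.** Consider any of these variants, and let $C_0$ be an initial labeling with $C_0(C_0(v))=C_0(v)$ for all $v$ (for example $C_0(v)=v$). Initially $P=C_0$ and no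 lock is held. 1. (Connectivity.) Let $G$ be an undirected graph on the vertices such that $C_0(u)=C_0(v)$ only if $u$ and $v$ are connected in $G$. Let $L_{\max}$ be any label, or none. Run concurrently one Union$(u,v)$ for every directed edge $(u,v)$ of $G$ with $C_0(u)\ne L_{\max}$. Under every schedule all these operations complete after finitely many steps, without deadlock. When they have completed, every vertex $v$ has a root $C(v)$ in $P$, and $C(u)=C(v)$ if and only if $u$ and $v$ are connected in $G$. 2. (Linearizability.) Consider any finite set of threads that invoke unions and finds in the phase-concurrent setting, that is, no operation is invoked while an operation of the other type is in progress. The history of every finite execution is linearizable with respect to the sequential union-find object whose state is a labeling, initially $C_0$, where Union$(u,v)$ gives all elements of the sets of $u$ and $v$ the smaller one of the two labels of these sets, and Find$(u)$ returns the label of $u$. (The Boolean returned by Union is not part of this object.) Moreover, at any point, if no more operations are invoked, then under every schedule all operations in progress complete after finitely many steps, without deadlock. -/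

import Mathlib

namespace RemUF

/-! ### Options -/

/-- The rules for `Find` (also called for path compression at the end of a `Union`). -/
inductive FindOption
  | naive
  | split
  | halve
  | compress

/-- The rules applied by a step of `Union` that is at a non-root vertex. -/
inductive SpliceOption
  | splitOne
  | halveOne
  | spliceAtomic

/-- `cas` is UF-Rem-CAS, `lock` is UF-Rem-Lock. -/
inductive UnionOption
  | cas
  | lock

/-- A variant of Rem's algorithm. The combination of full compression with
`spliceAtomic` is the only excluded one. -/
structure Variant where
  union : UnionOption
  find : FindOption
  splice : SpliceOption
  allowed : ¬ (find = FindOption.compress ∧ splice = SpliceOption.spliceAtomic)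

/-! ### Shared memory -/

/-- The shared memory: the parent array `P` and the array `L` of locks (`true` = held). -/
structure Mem (n : ℕ) where
  P : Fin n → Fin n
  L : Fin n → Bool

/-- The atomic write `P[x] ← y`. -/
def Mem.write {n : ℕ} (m : Mem n) (x y : Fin n) : Mem n :=
  { m with P := Function.update m.P x y }

/-- The memory after `L[x] ← b`. -/
def Mem.setLock {n : ℕ} (m : Mem n) (x : Fin n) (b : Bool) : Mem n :=
  { m with L := Function.update m.L x b }

/-- The memory after `CAS(&P[x], old, new)`; the CAS returns true iff `m.P x = old`. -/
def Mem.cas {n : ℕ} (m : Mem n) (x old new : Fin n) : Mem n :=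
  if m.P x = old then m.write x new else m

/-! ### Find

A program is a transition system on control points, which carry the values of the local
variables. Every step makes at most one access to the shared memory. -/

/-- Control points of the find procedures. -/
inductive FindPC (n : ℕ)
  /-- FindNaive: evaluate `v ≠ P[v]` -/
  | naiveTest (v : Fin n)
  /-- FindNaive: `v ← P[v]` -/
  | naiveMove (v : Fin n)
  /-- FindAtomicSplit, FindAtomicHalve: `v ← P[u]` -/
  | parent (u : Fin n)
  /-- FindAtomicSplit, FindAtomicHalve: `w ← P[v]`, and leave the loop if `v = w` -/
  | grandparent (u v : Fin n)
  /-- FindAtomicSplit, FindAtomicHalve: `CAS(&P[u], v, w)`; path splitting then sets `u ← v` -/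
  | shortcut (u v w : Fin n)
  /-- FindAtomicHalve: `u ← P[u]` -/
  | advance (u : Fin n)
  /-- FindCompress: `r ← u`, return `r` if `P[r] = r` -/
  | compFirst (u : Fin n)
  /-- FindCompress: evaluate `r ≠ P[r]` -/
  | compTest (u r : Fin n)
  /-- FindCompress: `r ← P[r]` -/
  | compMove (u r : Fin n)
  /-- FindCompress: `j ← P[u]`, and leave the loop unless `j > r` -/
  | compRead (u r : Fin n)
  /-- FindCompress: update `P[u]` to `r` (only if this lowers it), then `u ← j` -/
  | compWrite (u r j : Fin n)
  /-- the procedure has returned `r` -/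
  | ret (r : Fin n)

/-- First control point of the find procedure selected by the option. -/
def findStart {n : ℕ} : FindOption → Fin n → FindPC n
  | .naive, u => .naiveTest u
  | .split, u => .parent u
  | .halve, u => .parent u
  | .compress, u => .compFirst u

/-- One atomic step of a find procedure; `none` once it has returned. -/
def findStep {n : ℕ} (o : FindOption) (m : Mem n) : FindPC n → Option (FindPC n × Mem n)
  | .naiveTest v => some (if v = m.P v then .ret v else .naiveMove v, m)
  | .naiveMove v => some (.naiveTest (m.P v), m)
  | .parent u => some (.grandparent u (m.P u), m)
  | .grandparent u v => some (if v = m.P v then .ret v else .shortcut u v (m.P v), m)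
  | .shortcut u v w =>
      some (match o with
        | .halve => .advance u
        | _ => .parent v, m.cas u v w)
  | .advance u => some (.parent (m.P u), m)
  | .compFirst u => some (if m.P u = u then .ret u else .compTest u u, m)
  | .compTest u r => some (if r = m.P r then .compRead u r else .compMove u r, m)
  | .compMove u r => some (.compTest u (m.P r), m)
  | .compRead u r => some (if r < m.P u then .compWrite u r (m.P u) else .ret r, m)
  | .compWrite u r j => some (.compRead j r, m.write u (min (m.P u) r))
  | .ret _ => none

/-! ### Union -/

/-- Control points of `Union(u, v)`; `ru`, `rv` are the current vertices of the two paths. -/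
inductive UnionPC (n : ℕ)
  /-- loop test: read `P[ru]` -/
  | testU (ru rv : Fin n)
  /-- loop test: read `P[rv]`, compare with the value `a` read from `P[ru]`,
  and exchange the roles of `ru` and `rv` if `a` is the smaller one -/
  | testV (ru rv a : Fin n)
  /-- evaluate `ru = P[ru]` -/
  | rootTest (ru rv : Fin n)
  /-- UF-Rem-CAS: read the third argument `P[rv]` of the CAS -/
  | casRead (ru rv : Fin n)
  /-- UF-Rem-CAS: `CAS(&P[ru], ru, x)` -/
  | casLink (ru rv x : Fin n)
  /-- UF-Rem-Lock: `L[ru].Lock()`, blocked while the lock is held -/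
  | acquire (ru rv : Fin n)
  /-- UF-Rem-Lock: `pv ← P[rv]` -/
  | lockRead (ru rv : Fin n)
  /-- UF-Rem-Lock: evaluate `ru = P[ru] and ru > pv` -/
  | lockTest (ru rv pv : Fin n)
  /-- UF-Rem-Lock: `P[ru] ← pv` -/
  | lockWrite (ru rv pv : Fin n)
  /-- UF-Rem-Lock: `L[ru].Unlock()`; return true if `P[ru]` was written, else loop -/
  | release (ru rv : Fin n) (linked : Bool)
  /-- SplitAtomicOne, HalveAtomicOne: `v ← P[ru]` -/
  | oneParent (ru rv : Fin n)
  /-- SplitAtomicOne, HalveAtomicOne: `w ← P[v]` -/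
  | oneGrandparent (ru rv v : Fin n)
  /-- SplitAtomicOne, HalveAtomicOne: `CAS(&P[ru], v, w)` if `v ≠ w`;
  `ru` becomes `v`, respectively `w` -/
  | oneCas (ru rv v w : Fin n)
  /-- SpliceAtomic: `pu ← P[ru]` -/
  | spliceReadU (ru rv : Fin n)
  /-- SpliceAtomic: `pv ← P[rv]` -/
  | spliceReadV (ru rv pu : Fin n)
  /-- SpliceAtomic: `CAS(&P[ru], pu, pv)` if this lowers the parent; `ru` becomes `pu` -/
  | spliceCas (ru rv pu pv : Fin n)
  /-- running `Compress(u)`, to return `b` afterwards -/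
  | compressU (f : FindPC n) (b : Bool)
  /-- running `Compress(v)`, to return `b` afterwards -/
  | compressV (f : FindPC n) (b : Bool)
  /-- the operation has computed its return value `b` -/
  | ret (b : Bool)

/-- `Compress(u); Compress(v); return b`, or just `return b` if the option is FindNaive. -/
def compressThenReturn {n : ℕ} (o : FindOption) (u : Fin n) (b : Bool) : UnionPC n :=
  match o with
  | .naive => .ret b
  | o => .compressU (findStart o u) b

/-- Entry of the splice procedure. -/
def spliceStart {n : ℕ} (s : SpliceOption) (ru rv : Fin n) : UnionPC n :=
  match s with
  | .spliceAtomic => .spliceReadU ru rv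
  | _ => .oneParent ru rv

/-- One atomic step of `Union(u, v)`; `none` if it is blocked at a lock or has returned. -/
def unionStep {n : ℕ} (A : Variant) (u v : Fin n) (m : Mem n) :
    UnionPC n → Option (UnionPC n × Mem n)
  | .testU ru rv => some (.testV ru rv (m.P ru), m)
  | .testV ru rv a =>
      some (if a = m.P rv then
          match A.union with
          | .cas => .ret false
          | .lock => compressThenReturn A.find u false
        else if m.P rv < a then .rootTest ru rv
        else .rootTest rv ru, m)
  | .rootTest ru rv =>
      some (if ru = m.P ru then
          match A.union with
          | .cas => .casRead ru rv
          | .lock => .acquire ru rv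
        else spliceStart A.splice ru rv, m)
  | .casRead ru rv => some (.casLink ru rv (m.P rv), m)
  | .casLink ru rv x =>
      some (if m.P ru = ru then compressThenReturn A.find u true
        else spliceStart A.splice ru rv, m.cas ru ru x)
  | .acquire ru rv =>
      if m.L ru = true then none else some (.lockRead ru rv, m.setLock ru true)
  | .lockRead ru rv => some (.lockTest ru rv (m.P rv), m)
  | .lockTest ru rv pv =>
      some (if ru = m.P ru ∧ pv < ru then .lockWrite ru rv pv else .release ru rv false, m)
  | .lockWrite ru rv pv => some (.release ru rv true, m.write ru pv)
  | .release ru rv linked =>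
      some (if linked = true then .ret true else .testU ru rv, m.setLock ru false)
  | .oneParent ru rv => some (.oneGrandparent ru rv (m.P ru), m)
  | .oneGrandparent ru rv v => some (.oneCas ru rv v (m.P v), m)
  | .oneCas ru rv v w =>
      some (match A.splice with
        | .halveOne => .testU w rv
        | _ => .testU v rv, if v ≠ w then m.cas ru v w else m)
  | .spliceReadU ru rv => some (.spliceReadV ru rv (m.P ru), m)
  | .spliceReadV ru rv pu => some (.spliceCas ru rv pu (m.P rv), m)
  | .spliceCas ru rv pu pv => some (.testU pu rv, if pv < pu then m.cas ru pu pv else m)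
  | .compressU f b =>
      match findStep A.find m f with
      | some (f', m') => some (.compressU f' b, m')
      | none => some (.compressV (findStart A.find v) b, m)
  | .compressV f b =>
      match findStep A.find m f with
      | some (f', m') => some (.compressV f' b, m')
      | none => some (.ret b, m)
  | .ret _ => none

/-! ### Concurrent executions -/

/-- Operations of the union-find object. -/
inductive Op (n : ℕ)
  | union (u v : Fin n)
  | find (u : Fin n)

/-- Return values. -/
inductive Res (n : ℕ)
  | union (b : Bool)
  | find (r : Fin n)

/-- The state of an operation in progress. -/
inductive Local (n : ℕ)
  | union (u v : Fin n) (pc : UnionPC n)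
  | find (pc : FindPC n)

/-- The state in which an operation starts. -/
def Op.start {n : ℕ} (A : Variant) : Op n → Local n
  | .union u v => .union u v (.testU u v)
  | .find u => .find (findStart A.find u)

/-- One atomic step of an operation; `none` if it is blocked or has computed its result. -/
def Local.step {n : ℕ} (A : Variant) (m : Mem n) : Local n → Option (Local n × Mem n)
  | .union u v pc => (unionStep A u v m pc).map fun q => (.union u v q.1, q.2)
  | .find pc => (findStep A.find m pc).map fun q => (.find q.1, q.2)

/-- The computed return value, if any. -/
def Local.result {n : ℕ} : Local n → Option (Res n)
  | .union _ _ (.ret b) => some (.union b)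
  | .find (.ret r) => some (.find r)
  | _ => none

/-- The operation `o` is of the same type (union or find) as the operation in progress. -/
def Op.SameType {n : ℕ} : Op n → Local n → Prop
  | .union _ _, .union _ _ _ => True
  | .find _, .find _ => True
  | _, _ => False

/-- The shared memory and, for every thread, the operation it is executing (if any). -/
structure Config (ι : Type*) (n : ℕ) where
  mem : Mem n
  thread : ι → Option (Local n)

/-- One thread makes one atomic step inside its current operation. -/
def InternalStep {ι : Type*} [DecidableEq ι] {n : ℕ} (A : Variant) (c c' : Config ι n) : Prop :=
  ∃ (t : ι) (l l' : Local n) (m' : Mem n), c.thread t = some l ∧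
    l.step A c.mem = some (l', m') ∧ c' = ⟨m', Function.update c.thread t (some l')⟩

/-- Every operation in progress has computed its return value. -/
def Config.Finished {ι : Type*} {n : ℕ} (c : Config ι n) : Prop :=
  ∀ t l, c.thread t = some l → ∃ r, l.result = some r

/-- If no further operation is invoked, then under every schedule all operations in progress
complete: no infinite sequence of steps exists, and the system never gets stuck before. -/
def Terminates {ι : Type*} [DecidableEq ι] {n : ℕ} (A : Variant) (c : Config ι n) : Prop :=
  (¬ ∃ f : ℕ → Config ι n, f 0 = c ∧ ∀ k, InternalStep A (f k) (f (k + 1))) ∧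
  ∀ c', Relation.ReflTransGen (InternalStep A) c c' → c'.Finished ∨ ∃ c'', InternalStep A c' c''

/-- Invocations and responses of threads. -/
inductive Event (ι α ρ : Type*)
  | inv (t : ι) (o : α)
  | res (t : ι) (r : ρ)

/-- `PhaseExec A c H c'`: a phase-concurrent execution leads from `c` to `c'` and has the
history `H`. An operation is only invoked while no operation of the other type is in progress,
that is, unions and finds are separated by barriers. -/
inductive PhaseExec {ι : Type*} [DecidableEq ι] {n : ℕ} (A : Variant) (c₀ : Config ι n) :
    List (Event ι (Op n) (Res n)) → Config ι n → Prop
  | nil : PhaseExec A c₀ [] c₀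
  | invoke {H : List (Event ι (Op n) (Res n))} {c : Config ι n} (t : ι) (o : Op n) :
      PhaseExec A c₀ H c → c.thread t = none →
      (∀ t' l, c.thread t' = some l → o.SameType l) →
      PhaseExec A c₀ (H ++ [Event.inv t o])
        ⟨c.mem, Function.update c.thread t (some (o.start A))⟩
  | internal {H : List (Event ι (Op n) (Res n))} {c c' : Config ι n} :
      PhaseExec A c₀ H c → InternalStep A c c' → PhaseExec A c₀ H c'
  | respond {H : List (Event ι (Op n) (Res n))} {c : Config ι n} (t : ι) (l : Local n)
      (r : Res n) :
      PhaseExec A c₀ H c → c.thread t = some l → l.result = some r →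
      PhaseExec A c₀ (H ++ [Event.res t r]) ⟨c.mem, Function.update c.thread t none⟩

/-! ### Linearizability -/

/-- The status of a thread that uses an atomic object. -/
inductive Status (α ρ : Type*)
  | idle
  | pending (o : α)
  | applied (r : ρ)

/-- `AtomicExec δ s₀ H s st`: the history `H` arises when every operation is applied to the
sequential object with transition relation `δ` (state, operation, result, new state) and
initial state `s₀` at one instant, its linearization point, between its invocation and its
response; `s` and `st` are the final state and the final status of the threads. An operation
without response may or may not have been applied. -/
inductive AtomicExec {ι σ α ρ : Type*} [DecidableEq ι] (δ : σ → α → ρ → σ → Prop) (s₀ : σ) :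
    List (Event ι α ρ) → σ → (ι → Status α ρ) → Prop
  | nil : AtomicExec δ s₀ [] s₀ (fun _ => Status.idle)
  | invoke {H : List (Event ι α ρ)} {s : σ} {st : ι → Status α ρ} (t : ι) (o : α) :
      AtomicExec δ s₀ H s st → st t = Status.idle →
      AtomicExec δ s₀ (H ++ [Event.inv t o]) s (Function.update st t (Status.pending o))
  | linearize {H : List (Event ι α ρ)} {s s' : σ} {st : ι → Status α ρ} (t : ι) (o : α) (r : ρ) :
      AtomicExec δ s₀ H s st → st t = Status.pending o → δ s o r s' →
      AtomicExec δ s₀ H s' (Function.update st t (Status.applied r))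
  | respond {H : List (Event ι α ρ)} {s : σ} {st : ι → Status α ρ} (t : ι) (r : ρ) :
      AtomicExec δ s₀ H s st → st t = Status.applied r →
      AtomicExec δ s₀ (H ++ [Event.res t r]) s (Function.update st t Status.idle)

/-- The history `H` is linearizable with respect to the sequential object `δ`, `s₀`. -/
def Linearizable {ι σ α ρ : Type*} [DecidableEq ι] (δ : σ → α → ρ → σ → Prop) (s₀ : σ)
    (H : List (Event ι α ρ)) : Prop :=
  ∃ s st, AtomicExec δ s₀ H s st

/-- The sequential union-find object. A state assigns to each element the label of its set.
`union u v` merges the sets of `u` and `v` under the smaller one of their labels, and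
`find u` returns the label of `u`. The abstract union has no result, so every Boolean is
accepted as its return value. -/
def seqUnionFind {n : ℕ} (C : Fin n → Fin n) :
    Op n → Res n → (Fin n → Fin n) → Prop
  | .union u v, .union _, C' =>
      ∀ x, C' x = if C x = C u ∨ C x = C v then min (C u) (C v) else C x
  | .find u, .find r, C' => r = C u ∧ C' = C
  | _, _, _ => False

/-! ### Connectivity -/

/-- The configuration with parent array `C₀` and no operation in progress. -/
def idleConfig {n : ℕ} (ι : Type*) (C₀ : Fin n → Fin n) : Config ι n :=
  ⟨⟨C₀, fun _ => false⟩, fun _ => none⟩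

/-- The directed edges `(u, v)` of `G` that the connectivity algorithm processes, those with
`labels[u] ≠ Lmax`; for `Lmax = none` no edge is skipped. -/
def ProcessedEdge {n : ℕ} (G : SimpleGraph (Fin n)) (C₀ : Fin n → Fin n)
    (Lmax : Option (Fin n)) : Type :=
  {e : Fin n × Fin n // G.Adj e.1 e.2 ∧ some (C₀ e.1) ≠ Lmax}

instance {n : ℕ} (G : SimpleGraph (Fin n)) (C₀ : Fin n → Fin n) (Lmax : Option (Fin n)) :
    DecidableEq (ProcessedEdge G C₀ Lmax) :=
  inferInstanceAs (DecidableEq {e : Fin n × Fin n // G.Adj e.1 e.2 ∧ some (C₀ e.1) ≠ Lmax})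

/-- The start of the connectivity algorithm on the graph `G` with the labels `C₀`: in parallel,
one `Union(u, v)` for every processed edge. -/
def connectivityStart {n : ℕ} (A : Variant) (G : SimpleGraph (Fin n)) (C₀ : Fin n → Fin n)
    (Lmax : Option (Fin n)) : Config (ProcessedEdge G C₀ Lmax) n :=
  ⟨⟨C₀, fun _ => false⟩, fun e => some ((Op.union e.1.1 e.1.2).start A)⟩

/-- In the parent array `P`, the vertex `r` is the root of the tree that contains `v`. -/
def IsRootOf {n : ℕ} (P : Fin n → Fin n) (v r : Fin n) : Prop :=
  P r = r ∧ ∃ k : ℕ, P^[k] v = r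

/-- `C` is a connectivity labeling of `G`. -/
def IsConnectivityLabeling {n : ℕ} (G : SimpleGraph (Fin n)) (C : Fin n → Fin n) : Prop :=
  ∀ u v, C u = C v ↔ G.Reachable u v

end RemUF

namespace RemUF

/-! ### Leveled connectivity -/

/-! The danger is a stale read: a thread that acts on it later could cut a connection that nobody
restores. Leveled connectivity controls this. Let `R` be the set of initial roots. Every value ever
stored in `P` lies in `R`, parents only decrease, and the pointer of `x` is a link of level `rank R
x`, which is `x` for an initial root and `n` otherwise. A union whose loop is running owes a
connection: its obligation `(ru, rv, l)` counts as a link of level `l` between the current parents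
of `ru` and `rv`. `Conn` at `t` is the equivalence generated by the links of level at most `t`.

No step shrinks connectivity at any level (`Evolves`), and no step inside an operation enlarges it
at level `n + 1`, which contains all links (`Preserves`). A value `y` once read as the parent of `x`
stays connected with the current parent of `x` at level `y` (`Evolves.seen`), so outdated values
remain usable. A write that lowers `P u` is harmless if the old and the new parent are joined
afterwards at the level of the old parent (`Preserves.lower`). Connections strictly below that level
use neither the pointer of `u` nor an obligation that names `u` (`Conn.update`), so the write does
not destroy its own justification.

Shortcuts, full compression and links follow this pattern. `spliceAtomic` moves `ru` into another
tree, away from its old parent `pu`; the union then owes the connection of `pu` and `rv` at the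
lower level `pu` (`Preserves.splice`). FindCompress relies on an earlier root being in the same
tree. Connectivity at level `n` gives this only if all obligations have level `n + 1`
(`Conn.root_eq`), that is, without `spliceAtomic`: this is why that combination is excluded.

For termination, a step either lowers the sum of the parents or leaves `P` alone and lowers a bound
on the remaining steps of its thread (`Inv.measure_lt`); the holder of a lock is never blocked. For
connectivity, pointers and obligations initially generate reachability in `G`, and at the end no
obligation is left, so connectivity is equality of roots (`Inv.finished`). For linearizability,
every operation takes effect at its response, and level `n + 1` connectivity equals the equivalence
generated by the abstract labels and the unions in progress (`Simulates`). -/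

theorem eqvGen_le {α : Type*} {r s : α → α → Prop} (hs : Equivalence s)
    (h : ∀ a b, r a b → s a b) {a b : α} (hab : Relation.EqvGen r a b) : s a b := by
  induction hab with
  | rel _ _ h' => exact h _ _ h'
  | refl _ => exact hs.refl _
  | symm _ _ _ ih => exact hs.symm ih
  | trans _ _ _ _ _ ih₁ ih₂ => exact hs.trans ih₁ ih₂

section Graph

variable {n : ℕ}

open Classical in
/-- The level of the parent pointer of `x`, where `R` is the set of initial roots. -/
noncomputable def rank (R : Fin n → Prop) (x : Fin n) : ℕ := if R x then x else n

/-- Parents are initial roots, and parent pointers of initial roots point downwards. -/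
structure Good (R : Fin n → Prop) (P : Fin n → Fin n) : Prop where
  range : ∀ x, R (P x)
  le : ∀ x, R x → P x ≤ x

/-- Links of level at most `t`: parent pointers, and for every obligation `(a, b, l)` of `O` a
link of level `l` between the parents of `a` and `b`. -/
inductive Link (R : Fin n → Prop) (P : Fin n → Fin n) (O : Set (Fin n × Fin n × ℕ)) (t : ℕ) :
    Fin n → Fin n → Prop
  | parent (x : Fin n) : rank R x ≤ t → Link R P O t x (P x)
  | pair (a b : Fin n) (l : ℕ) : (a, b, l) ∈ O → l ≤ t → Link R P O t (P a) (P b)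

/-- Connectivity by links of level at most `t`. -/
def Conn (R : Fin n → Prop) (P : Fin n → Fin n) (O : Set (Fin n × Fin n × ℕ)) (t : ℕ) :
    Fin n → Fin n → Prop :=
  Relation.EqvGen (Link R P O t)

/-- The parents of the members of an obligation do not exceed its level. -/
def Bounded (P : Fin n → Fin n) (O : Set (Fin n × Fin n × ℕ)) : Prop :=
  ∀ a b l, (a, b, l) ∈ O → (P a).val ≤ l ∧ (P b).val ≤ l

/-- `y` has been read as the parent of `x` earlier. -/
structure Seen (R : Fin n → Prop) (P : Fin n → Fin n) (O : Set (Fin n × Fin n × ℕ))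
    (x y : Fin n) : Prop where
  le : P x ≤ y
  mem : R y
  conn : Conn R P O y (P x) y

/-- Parents decrease and no connection at any level is lost. -/
structure Evolves (R : Fin n → Prop) (P : Fin n → Fin n) (O : Set (Fin n × Fin n × ℕ))
    (P' : Fin n → Fin n) (O' : Set (Fin n × Fin n × ℕ)) : Prop where
  le : ∀ x, P' x ≤ P x
  conn : ∀ t x y, Conn R P O t x y → Conn R P' O' t x y
  drop : ∀ x, Conn R P' O' (P x) (P x) (P' x)

/-- Moreover, the overall connectivity does not change. -/
structure Preserves (R : Fin n → Prop) (P : Fin n → Fin n) (O : Set (Fin n × Fin n × ℕ))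
    (P' : Fin n → Fin n) (O' : Set (Fin n × Fin n × ℕ)) : Prop extends Evolves R P O P' O' where
  back : ∀ x y, Conn R P' O' (n + 1) x y → Conn R P O (n + 1) x y

variable {R : Fin n → Prop} {P P' P'' : Fin n → Fin n} {O O' O'' : Set (Fin n × Fin n × ℕ)}
  {s t : ℕ} {u v w x y z : Fin n}

theorem rank_of_mem (h : R x) : rank R x = x := by simp [rank, h]

theorem rank_le : rank R x ≤ n := by
  unfold rank
  split_ifs
  · exact x.isLt.le
  · exact le_rfl

theorem le_rank : x.val ≤ rank R x := by
  unfold rank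
  split_ifs
  · exact le_rfl
  · exact x.isLt.le

/-! ### Ranks and roots of the pointer forest. -/

namespace Good

theorem mem_of_root (h : Good R P) (hx : P x = x) : R x := hx ▸ h.range x

theorem lt_of_ne (h : Good R P) (hR : R x) (hx : P x ≠ x) : P x < x :=
  lt_of_le_of_ne (h.le x hR) hx

theorem rank_parent (h : Good R P) : rank R (P x) = (P x).val := rank_of_mem (h.range x)

/-- Parents are initial roots and have their own value as rank. A vertex outside `R` has rank `n`,
above all of them, so its pointer may go to a larger vertex without endangering acyclicity. -/
theorem rank_lt (h : Good R P) (hx : P x ≠ x) : rank R (P x) < rank R x := by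
  rw [h.rank_parent]
  by_cases hR : R x
  · rw [rank_of_mem hR]
    exact h.lt_of_ne hR hx
  · simp [rank, hR]

theorem parent_le_rank (h : Good R P) : (P x).val ≤ rank R x := by
  rw [← h.rank_parent]
  by_cases hx : P x = x
  · rw [hx]
  · exact (h.rank_lt hx).le

theorem iterate_fixed (h : Good R P) : ∀ (k : ℕ) (x : Fin n), rank R x ≤ k →
    P (P^[k] x) = P^[k] x := by
  intro k
  induction k with
  | zero =>
    intro x hx
    have h1 := h.parent_le_rank (x := x)
    have h2 := le_rank (R := R) (x := x)
    exact Fin.ext (by simp only [Function.iterate_zero, id]; omega)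
  | succ k ih =>
    intro x hx
    by_cases hp : P x = x
    · rw [Function.iterate_fixed hp, hp]
    · rw [Function.iterate_succ_apply]
      exact ih _ (by have := h.rank_lt hp; omega)

/-- The root of the tree that contains `x` is `P^[n] x`. -/
theorem root_fixed (h : Good R P) : P (P^[n] x) = P^[n] x := h.iterate_fixed n x rank_le

theorem root_parent (h : Good R P) : P^[n] (P x) = P^[n] x := by
  rw [← Function.iterate_succ_apply, Function.iterate_succ_apply', h.root_fixed]

theorem root_le (h : Good R P) (hR : R x) : P^[n] x ≤ x := by
  suffices ∀ k, R (P^[k] x) ∧ P^[k] x ≤ x from (this n).2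
  intro k
  induction k with
  | zero => exact ⟨hR, le_rfl⟩
  | succ k ih =>
    rw [Function.iterate_succ_apply']
    exact ⟨h.range _, (h.le _ ih.1).trans ih.2⟩

theorem root_of_fixed (hx : P x = x) : P^[n] x = x := Function.iterate_fixed hx n

theorem update (h : Good R P) (hw : R w) (hle : w ≤ P u) : Good R (Function.update P u w) := by
  constructor
  · intro x
    by_cases hx : x = u
    · subst hx; simpa using hw
    · simpa [hx] using h.range x
  · intro x hR
    by_cases hx : x = u
    · subst hx; simpa using hle.trans (h.le x hR)
    · simpa [hx] using h.le x hR

/-- Root status, once lost, never returns: a fixed point of `P'` is an initial root, and its pointer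
under `P` was already strictly below it. -/
theorem ne_of_le (h : Good R P) (h' : Good R P') (hle : P' x ≤ P x) (hx : P x ≠ x) :
    P' x ≠ x := by
  intro hx'
  have := h.lt_of_ne (h'.mem_of_root hx') hx
  omega

end Good

/-! ### Connectivity up to a level. -/

namespace Conn

theorem equivalence : Equivalence (Conn R P O t) := Relation.EqvGen.is_equivalence _

theorem refl (x : Fin n) : Conn R P O t x x := Relation.EqvGen.refl x

theorem symm (h : Conn R P O t x y) : Conn R P O t y x := Relation.EqvGen.symm _ _ h

theorem trans (h : Conn R P O t x y) (h' : Conn R P O t y z) : Conn R P O t x z :=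
  Relation.EqvGen.trans _ _ _ h h'

theorem parent (h : rank R x ≤ t) : Conn R P O t x (P x) := .rel _ _ (.parent x h)

theorem pair {a b : Fin n} {l : ℕ} (h : (a, b, l) ∈ O) (hl : l ≤ t) :
    Conn R P O t (P a) (P b) := .rel _ _ (.pair a b l h hl)

/-- The tool for comparing two states: only the generating links of the first have to be reconnected
in the second. -/
theorem lift (h : Conn R P O s x y) (hp : ∀ x, rank R x ≤ s → Conn R P' O' t x (P x))
    (hO : ∀ a b l, (a, b, l) ∈ O → l ≤ s → Conn R P' O' t (P a) (P b)) :
    Conn R P' O' t x y := by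
  refine eqvGen_le equivalence ?_ h
  rintro _ _ (⟨_, hx⟩ | ⟨_, _, _, hm, hl⟩)
  · exact hp _ hx
  · exact hO _ _ _ hm hl

theorem mono (h : Conn R P O s x y) (hst : s ≤ t) : Conn R P O t x y :=
  h.lift (fun _ hx => parent (hx.trans hst)) fun _ _ _ hm hl => pair hm (hl.trans hst)

theorem of_obligations (h : Conn R P O t x y)
    (hO : ∀ a b l, (a, b, l) ∈ O → l ≤ t → (a, b, l) ∈ O') : Conn R P O' t x y :=
  h.lift (fun _ hx => parent hx) fun _ _ _ hm hl => pair (hO _ _ _ hm hl) hl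

/-- Without obligations, connectivity means that the roots coincide. -/
theorem root_eq (hG : Good R P) (h : Conn R P O t x y)
    (hO : ∀ a b l, (a, b, l) ∈ O → t < l) : P^[n] x = P^[n] y := by
  refine eqvGen_le (s := fun x y => P^[n] x = P^[n] y) ⟨fun _ => rfl, fun h => h.symm,
    fun h h' => h.trans h'⟩ ?_ h
  rintro _ _ (⟨x, hx⟩ | ⟨a, b, l, hm, hl⟩)
  · exact hG.root_parent.symm
  · exact absurd (hO _ _ _ hm) (by omega)

/-- Ranks decrease along the path to the root, so its first link has the highest level. -/
theorem root (hG : Good R P) : Conn R P O (rank R x) x (P^[n] x) := by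
  suffices ∀ k x, Conn R P O (rank R x) x (P^[k] x) from this n x
  intro k
  induction k with
  | zero => exact fun x => refl x
  | succ k ih =>
    intro x
    rw [Function.iterate_succ_apply]
    refine (parent le_rfl).trans ((ih (P x)).mono ?_)
    rw [hG.rank_parent]
    exact hG.parent_le_rank

/-- Links below the old value of a lowered parent pointer are not affected. -/
theorem update (hG : Good R P) (hB : Bounded P O) (h : Conn R P O t x y) (ht : t < P u) :
    Conn R (Function.update P u w) O t x y := by
  refine h.lift (fun x hx => ?_) fun a b l hm hl => ?_
  -- The pointer of `u` has level at least `P u`, which exceeds `t`.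
  · have hxu : x ≠ u := by
      rintro rfl
      have := hG.parent_le_rank (x := x)
      omega
    simpa [hxu] using parent (R := R) (P := Function.update P u w) (O := O) hx
  -- By `Bounded`, an obligation naming `u` has level at least `P u` and is not used at `t` either.
  · have := hB a b l hm
    have ha : a ≠ u := by rintro rfl; omega
    have hb : b ≠ u := by rintro rfl; omega
    simpa [ha, hb] using pair (R := R) (P := Function.update P u w) hm hl

end Conn

/-! ### Transitions that lose no connection. -/

namespace Evolves

theorem refl : Evolves R P O P O := ⟨fun _ => le_rfl, fun _ _ _ h => h, fun _ => Conn.refl _⟩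

theorem trans (h : Evolves R P O P' O') (h' : Evolves R P' O' P'' O'') :
    Evolves R P O P'' O'' where
  le x := (h'.le x).trans (h.le x)
  conn t x y hc := h'.conn t x y (h.conn t x y hc)
  drop x := (h'.conn _ _ _ (h.drop x)).trans ((h'.drop x).mono (h.le x))

/-- This is the purpose of `drop`: each replacement of the parent of `x` is bridged at the level of
the replaced value, which is at most `y`. Hence a thread may act on `y` arbitrarily late. -/
theorem seen (h : Evolves R P O P' O') (hs : Seen R P O x y) : Seen R P' O' x y where
  le := (h.le x).trans hs.le
  mem := hs.mem
  conn := ((h.drop x).mono hs.le).symm.trans (h.conn _ _ _ hs.conn)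

end Evolves

namespace Preserves

theorem refl : Preserves R P O P O := ⟨Evolves.refl, fun _ _ h => h⟩

theorem trans (h : Preserves R P O P' O') (h' : Preserves R P' O' P'' O'') :
    Preserves R P O P'' O'' :=
  ⟨h.toEvolves.trans h'.toEvolves, fun x y hc => h.back x y (h'.back x y hc)⟩

theorem obligations (h : ∀ a b l, (a, b, l) ∈ O → Conn R P O' l (P a) (P b))
    (h' : ∀ a b l, (a, b, l) ∈ O' → l ≤ n + 1 → Conn R P O (n + 1) (P a) (P b)) :
    Preserves R P O P O' where
  le _ := le_rfl
  conn _ _ _ hc := hc.lift (fun _ hx => Conn.parent hx) fun a b l hm hl => (h a b l hm).mono hl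
  drop _ := Conn.refl _
  back _ _ hc := hc.lift (fun _ hx => Conn.parent hx) fun a b l hm hl => h' a b l hm hl

/-- Levels below the old parent do not see the write. At all other levels the connection `h`, which
must hold after the write, repairs every link that involves the parent of `u`. The converse at level
`n + 1` uses `hold`, the same connection before the write. -/
theorem lower (hG : Good R P) (hB : Bounded P O) (hw : w < P u)
    (h : Conn R (Function.update P u w) O (P u) (P u) w) (hold : Conn R P O (n + 1) (P u) w) :
    Preserves R P O (Function.update P u w) O where
  le x := by
    by_cases hx : x = u
    · subst hx; simpa using hw.le
    · simp [hx]
  drop x := by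
    by_cases hx : x = u
    · subst hx; simpa using h
    · simp only [Function.update_of_ne hx]; exact Conn.refl _
  conn t x y hc := by
    rcases lt_or_ge t (P u) with ht | ht
    · exact hc.update hG hB ht
    · have key : ∀ a, Conn R (Function.update P u w) O t (P a) (Function.update P u w a) := by
        intro a
        by_cases ha : a = u
        · subst ha; simpa using h.mono ht
        · simp only [Function.update_of_ne ha]; exact Conn.refl _
      exact hc.lift (fun x hx => (Conn.parent hx).trans (key x).symm) fun a b l hm hl =>
        (key a).trans ((Conn.pair hm hl).trans (key b).symm)
  back x y hc := by
    have key : ∀ a, Conn R P O (n + 1) (P a) (Function.update P u w a) := by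
      intro a
      by_cases ha : a = u
      · subst ha; simpa using hold
      · simp only [Function.update_of_ne ha]; exact Conn.refl _
    exact hc.lift (fun x hx => (Conn.parent (rank_le.trans (Nat.le_succ n))).trans (key x))
      fun a b l hm hl => (key a).symm.trans ((Conn.pair hm hl).trans (key b))

end Preserves

namespace Seen

theorem of_read (hG : Good R P) : Seen R P O x (P x) := ⟨le_rfl, hG.range x, Conn.refl _⟩

/-- The connection from `x` to a value read earlier. -/
theorem conn_self (h : Seen R P O x y) (hx : R x) (hy : y ≤ x) : Conn R P O x x y :=
  (Conn.parent (rank_of_mem hx).le).trans (h.conn.mono hy)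

end Seen

/-! ### Compression writes. -/

/-- Path splitting and halving: a parent is replaced by a value read as its own parent. -/
theorem Preserves.shortcut (hG : Good R P) (hB : Bounded P O) (hv : R v) (hwv : w < v)
    (hs : Seen R P O v w) (hu : P u = v) : Preserves R P O (Function.update P u w) O := by
  subst hu
  -- A root `u` would coincide with its parent `v`, and then `P u ≤ w < P u`.
  have hne : P u ≠ u := by
    intro h
    have := hs.le
    rw [h] at this hwv
    rw [h] at this
    omega
  have h1 : Conn R (Function.update P u w) O (P u) (P u) w := by
    have h2 : Conn R (Function.update P u w) O (P u) (P u) (P (P u)) := by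
      have := Conn.parent (R := R) (P := Function.update P u w) (O := O) (rank_of_mem hv).le
      simpa [hne] using this
    -- The first link is the pointer of the old parent itself; the stale remainder has level `w`,
    -- below the old parent, and therefore survives the write.
    exact h2.trans ((hs.conn.update hG hB hwv).mono hwv.le)
  refine .lower hG hB hwv h1 ((hs.conn_self hv hwv.le).mono ?_)
  omega

/-- Full compression: a parent is replaced by a lower member of the same tree. -/
theorem Preserves.compress (hG : Good R P) (hB : Bounded P O) (hR : R w) (hw : w < P u)
    (hroot : P^[n] u = P^[n] w) :
    P u ≠ u ∧ Preserves R P O (Function.update P u w) O := by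
  have h0 := hG.root_le hR
  have hne : P u ≠ u := by
    intro h
    rw [Good.root_of_fixed h] at hroot
    rw [h, hroot] at hw
    omega
  have hne' : P (P u) ≠ P u := by
    intro h
    rw [← hG.root_parent, Good.root_of_fixed h] at hroot
    rw [hroot] at hw
    omega
  have hlt := hG.lt_of_ne (hG.range u) hne'
  -- Both vertices reach the common root, and only by links of level below `P u`; this is the part
  -- that survives the write.
  have h1 : Conn R P O (max (P (P u)).val w.val) (P (P u)) w := by
    have h2 := Conn.root (O := O) (x := P (P u)) hG
    have h3 := Conn.root (O := O) (x := w) hG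
    rw [hG.root_parent, hG.root_parent, hroot, hG.rank_parent] at h2
    rw [rank_of_mem hR] at h3
    exact (h2.mono (le_max_left _ _)).trans (h3.symm.mono (le_max_right _ _))
  have hm : max (P (P u)).val w.val < P u := max_lt hlt hw
  refine ⟨hne, .lower hG hB hw ?_ ?_⟩
  · have h2 : Conn R (Function.update P u w) O (P u) (P u) (P (P u)) := by
      have := Conn.parent (R := R) (P := Function.update P u w) (O := O) (x := P u)
        (rank_of_mem (hG.range u)).le
      simpa [hne] using this
    exact h2.trans ((h1.update hG hB hm).mono hm.le)
  · exact (Conn.parent (rank_le.trans (Nat.le_succ n))).trans (h1.mono (by omega))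

end Graph

/-! ### Invariants of the find procedures -/

section Find

variable {n : ℕ} {R : Fin n → Prop} {P P' : Fin n → Fin n} {O O' : Set (Fin n × Fin n × ℕ)}
  {o : FindOption} {m m' : Mem n}

/-- The invariant of the local variables of a find procedure. -/
def FindInv (o : FindOption) (R : Fin n → Prop) (P : Fin n → Fin n)
    (O : Set (Fin n × Fin n × ℕ)) : FindPC n → Prop
  | .naiveTest _ => True
  | .naiveMove v => P v ≠ v
  | .parent _ => True
  | .grandparent u v => R v ∧ (v = u ∨ (P u ≠ u ∧ rank R v < rank R u))
  | .shortcut u v w =>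
      R v ∧ (v = u ∨ (P u ≠ u ∧ rank R v < rank R u)) ∧ w < v ∧ Seen R P O v w
  | .advance u => P u ≠ u
  | .compFirst _ => o = .compress
  | .compTest u r => o = .compress ∧ Conn R P O n u r
  | .compMove u r => o = .compress ∧ Conn R P O n u r ∧ P r ≠ r
  | .compRead u r => o = .compress ∧ Conn R P O n u r ∧ R r
  | .compWrite u r j =>
      o = .compress ∧ Conn R P O n u r ∧ R r ∧ Conn R P O n j r ∧ rank R j < rank R u
  | .ret _ => True

/-- All clauses are stable under interference: being a non-root, having seen a value and being
connected persist, and ranks are fixed. -/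
theorem FindInv.evolves {pc : FindPC n} (h : FindInv o R P O pc) (hG : Good R P)
    (hG' : Good R P') (hE : Evolves R P O P' O') : FindInv o R P' O' pc := by
  have hne : ∀ {x}, P x ≠ x → P' x ≠ x := fun hx => hG.ne_of_le hG' (hE.le _) hx
  cases pc with
  | naiveTest | parent | compFirst | ret => exact h
  | naiveMove v => exact hne h
  | grandparent u v => exact ⟨h.1, h.2.imp_right fun h => ⟨hne h.1, h.2⟩⟩
  | shortcut u v w =>
    exact ⟨h.1, h.2.1.imp_right fun h => ⟨hne h.1, h.2⟩, h.2.2.1, hE.seen h.2.2.2⟩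
  | advance u => exact hne h
  | compTest u r => exact ⟨h.1, hE.conn _ _ _ h.2⟩
  | compMove u r => exact ⟨h.1, hE.conn _ _ _ h.2.1, hne h.2.2⟩
  | compRead u r => exact ⟨h.1, hE.conn _ _ _ h.2.1, h.2.2⟩
  | compWrite u r j =>
    exact ⟨h.1, hE.conn _ _ _ h.2.1, h.2.2.1, hE.conn _ _ _ h.2.2.2.1, h.2.2.2.2⟩

theorem findInv_start (u : Fin n) : FindInv o R P O (findStart o u) := by
  cases o <;> simp [findStart, FindInv]

theorem Mem.cas_P (m : Mem n) (x a b : Fin n) :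
    (m.cas x a b).P = if m.P x = a then Function.update m.P x b else m.P := by
  unfold Mem.cas
  split_ifs <;> rfl

theorem Mem.cas_L (m : Mem n) (x a b : Fin n) : (m.cas x a b).L = m.L := by
  unfold Mem.cas
  split_ifs <;> rfl

theorem findStep_L {pc pc' : FindPC n} (hs : findStep o m pc = some (pc', m')) :
    m'.L = m.L := by
  cases pc <;> simp only [findStep, Option.some.injEq, Prod.mk.injEq, reduceCtorEq] at hs <;>
    obtain ⟨rfl, rfl⟩ := hs
  case shortcut => exact Mem.cas_L ..
  all_goals rfl

/-- A successful CAS certifies that `v` is still the parent of `u`, so only `w` may be outdated. It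
never hits a root: `u = v` would have a current parent at most `w < v`. -/
theorem cas_shortcut (hG : Good R m.P) (hB : Bounded m.P O) {u v w : Fin n} (hv : R v)
    (hwv : w < v) (hs : Seen R m.P O v w) :
    Good R (m.cas u v w).P ∧ Preserves R m.P O (m.cas u v w).P O ∧
      ∀ x, m.P x = x → (m.cas u v w).P x = x := by
  rw [Mem.cas_P]
  split_ifs with hu
  · refine ⟨hG.update hs.mem (hu ▸ hwv.le), .shortcut hG hB hv hwv hs hu, fun x hx => ?_⟩
    have hne : x ≠ u := by
      rintro rfl
      have := hs.le
      rw [← hu, hx, hx] at this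
      rw [← hu, hx] at hwv
      omega
    simpa [hne] using hx
  · exact ⟨hG, .refl, fun _ h => h⟩

/-- One step of a find procedure, in an environment with the obligations `O`. -/
theorem findStep_safe {pc pc' : FindPC n} (hG : Good R m.P) (hB : Bounded m.P O)
    (hO : o = .compress → ∀ a b l, (a, b, l) ∈ O → n < l) (hI : FindInv o R m.P O pc)
    (hs : findStep o m pc = some (pc', m')) :
    Good R m'.P ∧ Preserves R m.P O m'.P O ∧ FindInv o R m'.P O pc' ∧
      ∀ x, m.P x = x → m'.P x = x := by
  have hparent : ∀ x, Conn R m.P O n x (m.P x) := fun x => Conn.parent rank_le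
  cases pc <;> simp only [findStep, Option.some.injEq, Prod.mk.injEq, reduceCtorEq] at hs <;>
    obtain ⟨rfl, rfl⟩ := hs
  case naiveTest v =>
    refine ⟨hG, .refl, ?_, fun _ h => h⟩
    split_ifs with h
    · trivial
    · exact fun h' => h h'.symm
  case naiveMove v => exact ⟨hG, .refl, trivial, fun _ h => h⟩
  case parent u =>
    refine ⟨hG, .refl, ⟨hG.range u, ?_⟩, fun _ h => h⟩
    by_cases hu : m.P u = u
    · exact .inl hu
    · exact .inr ⟨hu, hG.rank_lt hu⟩
  case grandparent u v =>
    refine ⟨hG, .refl, ?_, fun _ h => h⟩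
    split_ifs with h
    · trivial
    · exact ⟨hI.1, hI.2, hG.lt_of_ne hI.1 fun h' => h h'.symm, .of_read hG⟩
  case shortcut u v w =>
    obtain ⟨h1, h2, h3⟩ := cas_shortcut (u := u) hG hB hI.1 hI.2.2.1 hI.2.2.2
    refine ⟨h1, h2, ?_, h3⟩
    have hne : m.P u ≠ u := by
      rcases hI.2.1 with rfl | h
      · exact (hI.2.2.2.le.trans_lt hI.2.2.1).ne
      · exact h.1
    cases o <;> first | trivial | exact hG.ne_of_le h1 (h2.le _) hne
  case advance u => exact ⟨hG, .refl, trivial, fun _ h => h⟩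
  case compFirst u =>
    refine ⟨hG, .refl, ?_, fun _ h => h⟩
    split_ifs with h
    · trivial
    · exact ⟨hI, Conn.refl _⟩
  case compTest u r =>
    refine ⟨hG, .refl, ?_, fun _ h => h⟩
    split_ifs with h
    · exact ⟨hI.1, hI.2, hG.mem_of_root h.symm⟩
    · exact ⟨hI.1, hI.2, fun h' => h h'.symm⟩
  case compMove u r =>
    exact ⟨hG, .refl, ⟨hI.1, hI.2.1.trans (hparent r)⟩, fun _ h => h⟩
  case compRead u r =>
    refine ⟨hG, .refl, ?_, fun _ h => h⟩
    split_ifs with h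
    · refine ⟨hI.1, hI.2.1, hI.2.2, (hparent u).symm.trans hI.2.1, hG.rank_lt fun hu => ?_⟩
      -- If `u` were a root, it would be the root of the tree of `r` and hence at most `r`, against
      -- `r < P u = u`.
      have h1 := hI.2.1.root_eq hG (hO hI.1)
      have h2 := hG.root_le hI.2.2
      rw [← h1, Good.root_of_fixed hu] at h2
      rw [hu] at h
      omega
    · trivial
  case compWrite u r j =>
    simp only [Mem.write]
    rcases le_or_gt (m.P u) r with h | h
    · rw [min_eq_left h, Function.update_eq_self]
      exact ⟨hG, .refl, ⟨hI.1, hI.2.2.2.1, hI.2.2.1⟩, fun _ h => h⟩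
    · rw [min_eq_right h.le]
      obtain ⟨hne, hp⟩ := Preserves.compress hG hB hI.2.2.1 h (hI.2.1.root_eq hG (hO hI.1))
      refine ⟨hG.update hI.2.2.1 h.le, hp, ⟨hI.1, hp.conn _ _ _ hI.2.2.2.1, hI.2.2.1⟩,
        fun x hx => ?_⟩
      have : x ≠ u := by rintro rfl; exact hne hx
      simpa [this] using hx

/-- All vertices of a find procedure satisfy `K`, and it only returns a root. -/
def FindTrack (K : Fin n → Prop) (P : Fin n → Fin n) : FindPC n → Prop
  | .naiveTest v => K v
  | .naiveMove v => K v
  | .parent u => K u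
  | .grandparent u v => K u ∧ K v
  | .shortcut u v _ => K u ∧ K v
  | .advance u => K u
  | .compFirst u => K u
  | .compTest _ r => K r
  | .compMove _ r => K r
  | .compRead _ r => K r ∧ P r = r
  | .compWrite _ r _ => K r ∧ P r = r
  | .ret r => K r ∧ P r = r

theorem findTrack_start {K : Fin n → Prop} {u : Fin n} (h : K u) :
    FindTrack K P (findStart o u) := by
  cases o <;> exact h

theorem FindTrack.of_roots {K : Fin n → Prop} {pc : FindPC n} (h : FindTrack K P pc)
    (hP : ∀ x, P x = x → P' x = x) : FindTrack K P' pc := by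
  cases pc <;> first | exact h | exact ⟨h.1, hP _ h.2⟩

/-- In the application `K` is a label class, closed under parents while no union runs. Persistence
of roots keeps an already found root valid until the response. -/
theorem FindTrack.step {K : Fin n → Prop} {pc pc' : FindPC n} (h : FindTrack K m.P pc)
    (hK : ∀ x, K x → K (m.P x)) (hP : ∀ x, m.P x = x → m'.P x = x)
    (hs : findStep o m pc = some (pc', m')) : FindTrack K m'.P pc' := by
  refine FindTrack.of_roots ?_ hP
  cases pc <;> simp only [findStep, Option.some.injEq, Prod.mk.injEq, reduceCtorEq] at hs <;>
    obtain ⟨rfl, rfl⟩ := hs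
  case naiveTest v =>
    split_ifs with hv
    · exact ⟨h, hv.symm⟩
    · exact h
  case naiveMove v => exact hK _ h
  case parent u => exact ⟨h, hK _ h⟩
  case grandparent u v =>
    split_ifs with hv
    · exact ⟨h.2, hv.symm⟩
    · exact h
  case shortcut u v w => cases o <;> first | exact h.1 | exact h.2
  case advance u => exact hK _ h
  case compFirst u =>
    split_ifs with hu
    · exact ⟨h, hu⟩
    · exact h
  case compTest u r =>
    split_ifs with hr
    · exact ⟨h, hr.symm⟩
    · exact h
  case compMove u r => exact hK _ h
  case compRead u r =>
    split_ifs
    · exact h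
    · exact h
  case compWrite u r j => exact h

end Find

/-! ### Invariants of unions -/

section Union

variable {n : ℕ} {R : Fin n → Prop} {P P' : Fin n → Fin n} {O O' : Set (Fin n × Fin n × ℕ)}
  {A : Variant} {m m' : Mem n} {l : ℕ} {ru rv a b x y : Fin n}

/-- The obligation of a union whose loop is still running. -/
def UnionPC.obligation (l : ℕ) : UnionPC n → Set (Fin n × Fin n × ℕ)
  | .testU ru rv => {(ru, rv, l)}
  | .testV ru rv _ => {(ru, rv, l)}
  | .rootTest ru rv => {(ru, rv, l)}
  | .casRead ru rv => {(ru, rv, l)}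
  | .casLink ru rv _ => {(ru, rv, l)}
  | .acquire ru rv => {(ru, rv, l)}
  | .lockRead ru rv => {(ru, rv, l)}
  | .lockTest ru rv _ => {(ru, rv, l)}
  | .lockWrite ru rv _ => {(ru, rv, l)}
  | .release ru rv false => {(ru, rv, l)}
  | .release _ _ true => ∅
  | .oneParent ru rv => {(ru, rv, l)}
  | .oneGrandparent ru rv _ => {(ru, rv, l)}
  | .oneCas ru rv _ _ => {(ru, rv, l)}
  | .spliceReadU ru rv => {(ru, rv, l)}
  | .spliceReadV ru rv _ => {(ru, rv, l)}
  | .spliceCas ru rv _ _ => {(ru, rv, l)}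
  | .compressU _ _ => ∅
  | .compressV _ _ => ∅
  | .ret _ => ∅

/-- The parent of `x` is below the level `l`, or `x` is the initial root `l`. -/
def Below (R : Fin n → Prop) (P : Fin n → Fin n) (l : ℕ) (x : Fin n) : Prop :=
  (P x).val < l ∨ (R x ∧ x.val = l)

/-- The invariant of the local variables of a union, whose obligation has level `l`. -/
def UnionInv (A : Variant) (R : Fin n → Prop) (P : Fin n → Fin n)
    (O : Set (Fin n × Fin n × ℕ)) (l : ℕ) : UnionPC n → Prop
  | .testU ru rv => Below R P l ru ∧ Below R P l rv
  | .testV ru rv a => (Below R P l ru ∧ Below R P l rv) ∧ Seen R P O ru a ∧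
      (a = ru ∨ (a.val < l ∧ P ru ≠ ru))
  | .rootTest ru rv => (Below R P l ru ∧ Below R P l rv) ∧ (P rv < ru ∨ P ru ≠ ru)
  | .casRead ru rv => (Below R P l ru ∧ Below R P l rv) ∧ A.union = .cas ∧
      (P rv < ru ∨ P ru ≠ ru)
  | .casLink ru rv x => (Below R P l ru ∧ Below R P l rv) ∧ A.union = .cas ∧
      Seen R P O rv x ∧ (x < ru ∨ P ru ≠ ru)
  | .acquire ru rv => (Below R P l ru ∧ Below R P l rv) ∧ A.union = .lock ∧
      (P rv < ru ∨ P ru ≠ ru)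
  | .lockRead ru rv => (Below R P l ru ∧ Below R P l rv) ∧ A.union = .lock ∧
      (P rv < ru ∨ P ru ≠ ru)
  | .lockTest ru rv pv => (Below R P l ru ∧ Below R P l rv) ∧ A.union = .lock ∧
      Seen R P O rv pv ∧ (pv < ru ∨ P ru ≠ ru)
  | .lockWrite ru rv pv => (Below R P l ru ∧ Below R P l rv) ∧ A.union = .lock ∧
      Seen R P O rv pv ∧ pv < ru ∧ P ru = ru
  | .release ru rv false => Below R P l ru ∧ Below R P l rv
  | .release _ _ true => True
  | .oneParent ru rv => (Below R P l ru ∧ Below R P l rv) ∧ P ru ≠ ru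
  | .oneGrandparent ru rv v => (Below R P l ru ∧ Below R P l rv) ∧ Seen R P O ru v ∧
      v.val < l ∧ rank R v < rank R ru
  | .oneCas ru rv v w => (Below R P l ru ∧ Below R P l rv) ∧ Seen R P O ru v ∧
      v.val < l ∧ rank R v < rank R ru ∧ Seen R P O v w ∧ w ≤ v
  | .spliceReadU ru rv => (Below R P l ru ∧ Below R P l rv) ∧ A.splice = .spliceAtomic ∧
      P ru ≠ ru
  | .spliceReadV ru rv pu => (Below R P l ru ∧ Below R P l rv) ∧ A.splice = .spliceAtomic ∧
      Seen R P O ru pu ∧ pu.val < l ∧ rank R pu < rank R ru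
  | .spliceCas ru rv pu pv => (Below R P l ru ∧ Below R P l rv) ∧ A.splice = .spliceAtomic ∧
      Seen R P O ru pu ∧ pu.val < l ∧ rank R pu < rank R ru ∧ Seen R P O rv pv
  | .compressU f _ => FindInv A.find R P O f
  | .compressV f _ => FindInv A.find R P O f
  | .ret _ => True

/-- The lock held by a union. -/
def UnionPC.held : UnionPC n → Option (Fin n)
  | .lockRead ru _ => some ru
  | .lockTest ru _ _ => some ru
  | .lockWrite ru _ _ => some ru
  | .release ru _ _ => some ru
  | _ => none

namespace Below

theorem evolves (h : Below R P l x) (hE : Evolves R P O P' O') : Below R P' l x :=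
  h.imp_left fun h => lt_of_le_of_lt (hE.le x) h

theorem le (hG : Good R P) (h : Below R P l x) : (P x).val ≤ l := by
  rcases h with h | ⟨h, rfl⟩
  · exact h.le
  · exact hG.le x h

/-- The strict inequality is what lets a union step to the parent: connections at the level of that
parent cannot use the union's own obligation. -/
theorem lt (hG : Good R P) (h : Below R P l x) (hx : P x ≠ x) : (P x).val < l := by
  rcases h with h | ⟨h, rfl⟩
  · exact h
  · exact hG.lt_of_ne h hx

theorem of_lt (hG : Good R P) (hx : R x) (hl : x.val < l) : Below R P l x :=
  .inl (lt_of_le_of_lt (hG.le x hx) hl)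

/-- Unions start at level `n + 1`, above all vertices, where nothing has to be checked. -/
theorem of_succ : Below R P (n + 1) x := .inl (by omega)

end Below

/-- Only `lockWrite` relies on something that interference could destroy, namely that `ru` is still
a root; `hL` is the protection given by the lock. -/
theorem UnionInv.evolves {pc : UnionPC n} (h : UnionInv A R P O l pc) (hG : Good R P)
    (hG' : Good R P') (hE : Evolves R P O P' O')
    (hL : ∀ r, A.union = .lock → pc.held = some r → P r = r → P' r = r) :
    UnionInv A R P' O' l pc := by
  have hne : ∀ {x}, P x ≠ x → P' x ≠ x := fun hx => hG.ne_of_le hG' (hE.le _) hx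
  have hb : ∀ {x y}, Below R P l x ∧ Below R P l y → Below R P' l x ∧ Below R P' l y :=
    fun h => ⟨h.1.evolves hE, h.2.evolves hE⟩
  have hlt : ∀ {x y}, P x < y ∨ P y ≠ y → P' x < y ∨ P' y ≠ y :=
    fun h => h.imp (lt_of_le_of_lt (hE.le _)) hne
  have hs : ∀ {x y}, Seen R P O x y → Seen R P' O' x y := hE.seen
  cases pc with
  | testU => exact hb h
  | testV => exact ⟨hb h.1, hs h.2.1, h.2.2.imp_right fun h => ⟨h.1, hne h.2⟩⟩
  | rootTest => exact ⟨hb h.1, hlt h.2⟩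
  | casRead | acquire | lockRead => exact ⟨hb h.1, h.2.1, hlt h.2.2⟩
  | casLink | lockTest => exact ⟨hb h.1, h.2.1, hs h.2.2.1, h.2.2.2.imp_right hne⟩
  | lockWrite =>
    exact ⟨hb h.1, h.2.1, hs h.2.2.1, h.2.2.2.1, hL _ h.2.1 rfl h.2.2.2.2⟩
  | release _ _ b =>
    cases b
    · exact hb h
    · trivial
  | oneParent => exact ⟨hb h.1, hne h.2⟩
  | oneGrandparent => exact ⟨hb h.1, hs h.2.1, h.2.2⟩
  | oneCas => exact ⟨hb h.1, hs h.2.1, h.2.2.1, h.2.2.2.1, hs h.2.2.2.2.1, h.2.2.2.2.2⟩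
  | spliceReadU => exact ⟨hb h.1, h.2.1, hne h.2.2⟩
  | spliceReadV => exact ⟨hb h.1, h.2.1, hs h.2.2.1, h.2.2.2⟩
  | spliceCas =>
    exact ⟨hb h.1, h.2.1, hs h.2.2.1, h.2.2.2.1, h.2.2.2.2.1, hs h.2.2.2.2.2⟩
  | compressU | compressV => exact FindInv.evolves h hG hG' hE
  | ret => trivial

theorem unionInv_compressThenReturn (u : Fin n) (b : Bool) :
    UnionInv A R P O l (compressThenReturn A.find u b) := by
  unfold compressThenReturn
  split
  · trivial
  · exact findInv_start u

theorem obligation_compressThenReturn (u : Fin n) (b : Bool) :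
    (compressThenReturn A.find u b).obligation l = ∅ := by
  unfold compressThenReturn
  split <;> rfl

theorem unionInv_spliceStart (h : Below R P l ru ∧ Below R P l rv) (hr : P ru ≠ ru) :
    UnionInv A R P O l (spliceStart A.splice ru rv) := by
  unfold spliceStart
  split
  · exact ⟨h, ‹_›, hr⟩
  · exact ⟨h, hr⟩

theorem obligation_spliceStart (s : SpliceOption) :
    (spliceStart s ru rv).obligation l = {(ru, rv, l)} := by
  cases s <;> rfl

theorem UnionPC.bounded_obligation (hG : Good R P) {pc : UnionPC n} (h : UnionInv A R P O l pc) :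
    Bounded P (pc.obligation l) := by
  have key : ∀ {ru rv}, Below R P l ru ∧ Below R P l rv → Bounded P {(ru, rv, l)} := by
    rintro ru rv ⟨h, h'⟩ a b l' hm
    simp only [Set.mem_singleton_iff, Prod.mk.injEq] at hm
    obtain ⟨rfl, rfl, rfl⟩ := hm
    exact ⟨h.le hG, h'.le hG⟩
  cases pc
  case release _ _ b =>
    cases b
    · exact key h
    · exact fun _ _ _ h => h.elim
  all_goals first
    | exact fun _ _ _ h => h.elim
    | exact key h.1
    | exact key h

/-! ### Moving, discharging and splicing obligations. -/

/-- An obligation has no influence on lower levels. -/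
theorem Conn.drop_obligation {t : ℕ} (h : Conn R P (O ∪ {(a, b, l)}) t x y) (ht : t < l) :
    Conn R P O t x y := by
  refine h.of_obligations fun a' b' l' hm hl => hm.resolve_right ?_
  simp only [Set.mem_singleton_iff, Prod.mk.injEq]
  omega

theorem Conn.union_left {t : ℕ} (h : Conn R P O t x y) : Conn R P (O ∪ O') t x y :=
  h.of_obligations fun _ _ _ hm _ => .inl hm

theorem Bounded.insert (hB : Bounded P O) (ha : (P a).val ≤ l) (hb : (P b).val ≤ l) :
    Bounded P (O ∪ {(a, b, l)}) := by
  rintro a' b' l' (hm | hm)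
  · exact hB _ _ _ hm
  · obtain ⟨⟩ := hm
    exact ⟨ha, hb⟩

/-- The obligations `S` of one thread are replaced by `S'`. -/
theorem Preserves.replace {S S' : Set (Fin n × Fin n × ℕ)}
    (h : ∀ a b l, (a, b, l) ∈ S → Conn R P (O ∪ S') l (P a) (P b))
    (h' : ∀ a b l, (a, b, l) ∈ S' → l ≤ n + 1 → Conn R P (O ∪ S) (n + 1) (P a) (P b)) :
    Preserves R P (O ∪ S) P (O ∪ S') :=
  .obligations (fun a b l hm => hm.elim (fun hm => .pair (.inl hm) le_rfl) (h a b l))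
    fun a b l hm hl => hm.elim (fun hm => .pair (.inl hm) hl) fun hm => h' a b l hm hl

theorem Preserves.swap : Preserves R P (O ∪ {(a, b, l)}) P (O ∪ {(b, a, l)}) := by
  refine .replace ?_ ?_ <;> rintro _ _ _ ⟨⟩
  · exact (Conn.pair (.inr rfl) le_rfl).symm
  · exact fun hl => (Conn.pair (.inr rfl) hl).symm

theorem Preserves.discharge (h : Conn R P O l (P a) (P b)) :
    Preserves R P (O ∪ {(a, b, l)}) P (O ∪ ∅) := by
  refine .replace ?_ ?_ <;> rintro _ _ _ ⟨⟩
  exact h.union_left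

/-- The first vertex of an obligation is replaced by a value read as its parent. -/
theorem Preserves.move (hs : Seen R P (O ∪ {(a, b, l)}) a x) (hx : x.val < l) :
    Preserves R P (O ∪ {(a, b, l)}) P (O ∪ {(x, b, l)}) := by
  -- As `x < l`, this connection does not use the obligation that is about to be dropped, so the
  -- replacement is not circular.
  have h1 : Conn R P O l (P a) (P x) :=
    (hs.conn.drop_obligation hx).mono hx.le |>.trans
      (Conn.parent ((rank_of_mem hs.mem).trans_le hx.le))
  refine .replace ?_ ?_ <;> rintro _ _ _ ⟨⟩
  · exact h1.union_left.trans (Conn.pair (.inr rfl) le_rfl)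
  · exact fun hl => (h1.union_left.mono hl).symm.trans (Conn.pair (.inr rfl) hl)

/-- The value seen as the parent of `a` equals the parent of `b`. If it is below `l`, the two
parents are joined without the obligation. Otherwise `b` is a root and equals `a`. -/
theorem Preserves.exit (hG : Good R P) (hs : Seen R P (O ∪ {(a, b, l)}) a (P b))
    (h : P b = a ∨ (P b).val < l) (hb : Below R P l b) :
    Preserves R P (O ∪ {(a, b, l)}) P (O ∪ ∅) := by
  refine .discharge ?_
  rcases lt_or_ge (P b).val l with hl | hl
  · exact (hs.conn.drop_obligation hl).mono hl.le
  · obtain ⟨hR, hbl⟩ := hb.resolve_left (by omega)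
    have h1 : P b = b := le_antisymm (hG.le b hR) (by rw [Fin.le_def]; omega)
    have h2 : P b = a := h.resolve_right (by omega)
    rw [← h2, h1]
    exact h1.symm ▸ Conn.refl _

/-- The new pointer of the former root `a` bridges the write at level `a`. Afterwards `x`, the
parent of `a`, is joined with the parent of `b` below level `l`, so the debt is paid. -/
theorem Preserves.link (hG : Good R P) (hB : Bounded P O) (hl : l ≤ n + 1) (ha : P a = a)
    (hal : Below R P l a) (hbl : Below R P l b) (hx : x < a)
    (hs : Seen R P (O ∪ {(a, b, l)}) b x) :
    Preserves R P (O ∪ {(a, b, l)}) (Function.update P a x) (O ∪ ∅) := by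
  have hxa : x < P a := by rwa [ha]
  have hle := hal.le hG
  have hba : b ≠ a := by
    rintro rfl
    have := hs.le
    rw [ha] at this
    omega
  have hB' : Bounded P (O ∪ {(a, b, l)}) := hB.insert hle (hbl.le hG)
  refine (Preserves.lower hG hB' hxa ?_ ?_).trans (.discharge ?_)
  · have := Conn.parent (R := R) (P := Function.update P a x) (O := O ∪ {(a, b, l)})
      (rank_of_mem (hG.mem_of_root ha)).le
    rw [Function.update_self] at this
    rwa [ha]
  · exact (Conn.pair (.inr rfl) hl).trans (hs.conn.mono (by omega))
  · rw [Function.update_self, Function.update_of_ne hba]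
    have hxl : x.val < l := by omega
    exact ((hs.conn.drop_obligation hxl).update hG hB hxa).symm.mono hxl.le

/-- Splicing moves `a` below `y`, and `x`, the old parent of `a`, takes the place of `a` in the
obligation, whose level becomes `x`. -/
theorem Preserves.splice (hG : Good R P) (hB : Bounded P O) (hl : l ≤ n + 1)
    (hal : Below R P l a) (hbl : Below R P l b) (hx : P a = x) (hxa : x ≠ a) (hxl : x.val < l)
    (hyx : y < x) (hs : Seen R P (O ∪ {(a, b, l)}) b y) :
    Preserves R P (O ∪ {(a, b, l)}) (Function.update P a y) (O ∪ {(x, b, x.val)}) := by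
  have hya : y < P a := by rwa [hx]
  have hR : R x := hx ▸ hG.range a
  have hba : b ≠ a := by
    rintro rfl
    have := hs.le
    omega
  have hn : n ≤ n + 1 := Nat.le_succ n
  -- Adding the new obligation before the write enlarges nothing at level `n + 1`: `x = P a` is
  -- already joined with `P b` by the old one.
  have h1 : Preserves R P (O ∪ {(a, b, l)}) P (O ∪ {(a, b, l), (x, b, x.val)}) := by
    refine .replace ?_ ?_
    · rintro _ _ _ ⟨⟩
      exact Conn.pair (.inr (.inl rfl)) le_rfl
    · rintro _ _ _ (⟨⟨⟩⟩ | ⟨⟨⟩⟩) hl'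
      · exact Conn.pair (.inr rfl) hl'
      · refine (Conn.parent (rank_le.trans hn)).symm.trans ?_
        rw [← hx]
        exact Conn.pair (.inr rfl) hl
  refine h1.trans ((Preserves.lower (w := y) hG ?_ hya ?_ ?_).trans (.replace ?_ ?_))
  · rintro _ _ _ (hm | ⟨⟨⟩⟩ | ⟨⟨⟩⟩)
    · exact hB _ _ _ hm
    · exact ⟨hal.le hG, hbl.le hG⟩
    · exact ⟨hG.le x hR, (Fin.le_def.1 hs.le).trans hyx.le⟩
  -- From `x` to `y` after the write: the pointer of `x` and the new obligation, both of level `x`,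
  -- then the stale connection from `P b` to `y`, of level `y < x`.
  · rw [hx]
    have h2 := Conn.parent (R := R) (P := Function.update P a y)
      (O := O ∪ {(a, b, l), (x, b, x.val)}) (rank_of_mem hR).le
    have h3 := Conn.pair (R := R) (P := Function.update P a y) (t := x.val)
      (O := O ∪ {(a, b, l), (x, b, x.val)}) (.inr (.inr rfl)) le_rfl
    have h4 := (hs.conn.drop_obligation (O := O) (by omega)).update (w := y) hG hB hya
    rw [Function.update_of_ne hba] at h3
    exact h2.trans (h3.trans (h4.union_left.mono hyx.le))
  · exact (Conn.pair (.inr (.inl rfl)) hl).trans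
      (h1.conn _ _ _ (hs.conn.mono (by omega)))
  -- The old obligation has become redundant, since the parent of `a` is now `y`, which is joined
  -- with `P b` at level `y`.
  · rintro _ _ _ (⟨⟨⟩⟩ | ⟨⟨⟩⟩)
    · rw [Function.update_self, Function.update_of_ne hba]
      exact (((hs.conn.drop_obligation (O := O) (by omega)).update hG hB hya).symm.mono
        (by omega)).union_left
    · exact Conn.pair (.inr rfl) le_rfl
  · rintro _ _ _ ⟨⟩ hl'
    exact Conn.pair (.inr (.inr rfl)) hl'

end Union

/-! ### Single steps of a union: safety, roots and locks. -/

section UnionStep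

variable {n : ℕ} {R : Fin n → Prop} {O : Set (Fin n × Fin n × ℕ)}
  {A : Variant} {m m' : Mem n} {l : ℕ} {pc pc' : UnionPC n} {u v : Fin n}

/-- A step from `pc` to `pc'` keeps all invariants, for a suitable new level of the obligation;
`O` are the obligations of the other threads. -/
def UnionStepSafe (A : Variant) (R : Fin n → Prop) (O : Set (Fin n × Fin n × ℕ)) (m m' : Mem n)
    (l : ℕ) (pc pc' : UnionPC n) : Prop :=
  Good R m'.P ∧ ∃ l' ≤ n + 1, (A.splice ≠ .spliceAtomic → l' = n + 1) ∧
    Preserves R m.P (O ∪ pc.obligation l) m'.P (O ∪ pc'.obligation l') ∧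
    UnionInv A R m'.P (O ∪ pc'.obligation l') l' pc'

/-- One step of a union. -/
theorem unionStep_safe (hG : Good R m.P) (hB : Bounded m.P O)
    (hO : A.splice ≠ .spliceAtomic → ∀ a b l, (a, b, l) ∈ O → l = n + 1) (hl : l ≤ n + 1)
    (hl' : A.splice ≠ .spliceAtomic → l = n + 1)
    (hI : UnionInv A R m.P (O ∪ pc.obligation l) l pc)
    (hs : unionStep A u v m pc = some (pc', m')) : UnionStepSafe A R O m m' l pc pc' := by
  have stay : ∀ pc' : UnionPC n, pc'.obligation l = pc.obligation l →
      UnionInv A R m.P (O ∪ pc'.obligation l) l pc' → UnionStepSafe A R O m m l pc pc' :=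
    fun pc' ho hI => ⟨hG, l, hl, hl', ho ▸ .refl, hI⟩
  have hfind : ∀ f f' : FindPC n, FindInv A.find R m.P O f →
      findStep A.find m f = some (f', m') →
      Good R m'.P ∧ Preserves R m.P O m'.P O ∧ FindInv A.find R m'.P O f' := by
    intro f f' hf hs
    have := findStep_safe hG hB (fun hc a b l hm => ?_) hf hs
    · exact ⟨this.1, this.2.1, this.2.2.1⟩
    -- Full compression excludes `spliceAtomic`, so every obligation still has its initial level `n
    -- + 1`.
    · rw [hO (fun h => A.allowed ⟨hc, h⟩) a b l hm]
      omega
  cases pc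
  case compressU f b =>
    simp only [UnionInv, UnionPC.obligation, Set.union_empty] at hI
    simp only [unionStep] at hs
    split at hs <;> simp only [Option.some.injEq, Prod.mk.injEq] at hs <;> obtain ⟨rfl, rfl⟩ := hs
    · obtain ⟨h1, h2, h3⟩ := hfind _ _ hI ‹_›
      exact ⟨h1, l, hl, hl', by simpa only [UnionPC.obligation, Set.union_empty] using h2,
        by simpa only [UnionInv, UnionPC.obligation, Set.union_empty] using h3⟩
    · exact stay _ rfl (findInv_start v)
  case compressV f b =>
    simp only [UnionInv, UnionPC.obligation, Set.union_empty] at hI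
    simp only [unionStep] at hs
    split at hs <;> simp only [Option.some.injEq, Prod.mk.injEq] at hs <;> obtain ⟨rfl, rfl⟩ := hs
    · obtain ⟨h1, h2, h3⟩ := hfind _ _ hI ‹_›
      exact ⟨h1, l, hl, hl', by simpa only [UnionPC.obligation, Set.union_empty] using h2,
        by simpa only [UnionInv, UnionPC.obligation, Set.union_empty] using h3⟩
    · exact stay _ rfl trivial
  case acquire ru rv =>
    simp only [unionStep] at hs
    split_ifs at hs
    simp only [Option.some.injEq, Prod.mk.injEq] at hs
    obtain ⟨rfl, rfl⟩ := hs
    exact stay _ rfl hI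
  all_goals
    simp only [unionStep, Option.some.injEq, Prod.mk.injEq, reduceCtorEq] at hs
    try obtain ⟨rfl, rfl⟩ := hs
  case testU ru rv =>
    refine stay _ rfl ⟨hI, .of_read hG, ?_⟩
    by_cases hr : m.P ru = ru
    · exact .inl hr
    · exact .inr ⟨hI.1.lt hG hr, hr⟩
  case testV ru rv a =>
    obtain ⟨hb, hs, ha⟩ := hI
    split_ifs with h1 h2
    · subst h1
      have hp := Preserves.exit hG hs (ha.imp_right fun h => h.1) hb.2
      split
      · exact ⟨hG, l, hl, hl', hp, trivial⟩
      · exact ⟨hG, l, hl, hl', by rwa [obligation_compressThenReturn],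
          unionInv_compressThenReturn _ _⟩
    · refine stay _ rfl ⟨hb, ?_⟩
      rcases ha with rfl | ha
      · exact .inl h2
      · exact .inr ha.2
    -- After the exchange, a link at a root `rv` points downwards: `P ru ≤ a < P rv = rv`.
    · refine ⟨hG, l, hl, hl', .swap, hb.symm, ?_⟩
      by_cases hr : m.P rv = rv
      · left
        have := hs.le
        rw [hr] at h1 h2
        omega
      · exact .inr hr
  case rootTest ru rv =>
    split_ifs with h1
    · split
      · exact stay _ rfl ⟨hI.1, ‹_›, hI.2⟩
      · exact stay _ rfl ⟨hI.1, ‹_›, hI.2⟩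
    · exact stay _ (obligation_spliceStart _) (unionInv_spliceStart hI.1 fun h => h1 h.symm)
  case casRead ru rv => exact stay _ rfl ⟨hI.1, hI.2.1, .of_read hG, hI.2.2⟩
  case casLink ru rv x =>
    obtain ⟨hb, -, hs, hx⟩ := hI
    unfold Mem.cas
    split_ifs with h1
    · have hx := hx.resolve_right fun h => h h1
      exact ⟨hG.update hs.mem (by rw [h1]; exact hx.le), l, hl, hl',
        by rw [obligation_compressThenReturn]; exact .link hG hB hl h1 hb.1 hb.2 hx hs,
        unionInv_compressThenReturn _ _⟩
    · exact stay _ (obligation_spliceStart _) (unionInv_spliceStart hb h1)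
  case lockRead ru rv => exact stay _ rfl ⟨hI.1, hI.2.1, .of_read hG, hI.2.2⟩
  case lockTest ru rv pv =>
    split_ifs with h1
    · exact stay _ rfl ⟨hI.1, hI.2.1, hI.2.2.1, h1.2, h1.1.symm⟩
    · exact stay _ rfl hI.1
  case lockWrite ru rv pv =>
    obtain ⟨hb, -, hs, hx, hr⟩ := hI
    exact ⟨hG.update hs.mem (by rw [hr]; exact hx.le), l, hl, hl',
      .link hG hB hl hr hb.1 hb.2 hx hs, trivial⟩
  case release ru rv linked =>
    cases linked
    · exact stay _ rfl hI
    · exact stay _ rfl trivial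
  case oneParent ru rv =>
    exact stay _ rfl ⟨hI.1, .of_read hG, hI.1.1.lt hG hI.2, hG.rank_lt hI.2⟩
  case oneGrandparent ru rv v =>
    exact stay _ rfl ⟨hI.1, hI.2.1, hI.2.2.1, hI.2.2.2, .of_read hG, hG.le v hI.2.1.mem⟩
  case oneCas ru rv v w =>
    obtain ⟨hb, hsv, hvl, -, hsw, hwv⟩ := hI
    have hB' : Bounded m.P (O ∪ {(ru, rv, l)}) := hB.insert (hb.1.le hG) (hb.2.le hG)
    obtain ⟨hG', hp⟩ : Good R (if v ≠ w then m.cas ru v w else m).P ∧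
        Preserves R m.P (O ∪ {(ru, rv, l)}) (if v ≠ w then m.cas ru v w else m).P
          (O ∪ {(ru, rv, l)}) := by
      split_ifs with h1
      · have := cas_shortcut (u := ru) hG hB' hsv.mem (lt_of_le_of_ne hwv (Ne.symm h1)) hsw
        exact ⟨this.1, this.2.1⟩
      · exact ⟨hG, .refl⟩
    have hm := Preserves.move (hp.seen hsv) hvl
    -- Halving amounts to two moves, the second one along the possibly outdated `w`.
    have hm' := Preserves.move (hm.seen (hp.seen hsw)) (lt_of_le_of_lt hwv hvl)
    have hb' := hb.2.evolves hp.toEvolves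
    generalize (if v ≠ w then m.cas ru v w else m) = m₁ at *
    split
    · exact ⟨hG', l, hl, hl', hp.trans (hm.trans hm'),
        .of_lt hG' hsw.mem (lt_of_le_of_lt hwv hvl), hb'⟩
    · exact ⟨hG', l, hl, hl', hp.trans hm, .of_lt hG' hsv.mem hvl, hb'⟩
  case spliceReadU ru rv =>
    exact stay _ rfl ⟨hI.1, hI.2.1, .of_read hG, hI.1.1.lt hG hI.2.2, hG.rank_lt hI.2.2⟩
  case spliceReadV ru rv pu =>
    exact stay _ rfl ⟨hI.1, hI.2.1, hI.2.2.1, hI.2.2.2.1, hI.2.2.2.2, .of_read hG⟩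
  case spliceCas ru rv pu pv =>
    obtain ⟨hb, hA, hsu, hul, hrk, hsv⟩ := hI
    have hmove : UnionStepSafe A R O m m l (.spliceCas ru rv pu pv) (.testU pu rv) :=
      ⟨hG, l, hl, hl', .move hsu hul, .of_lt hG hsu.mem hul, hb.2⟩
    unfold Mem.cas
    split_ifs with h1 h2
    · have hne : pu ≠ ru := by
        rintro rfl
        exact lt_irrefl _ hrk
      have hp := Preserves.splice hG hB hl hb.1 hb.2 h2 hne hul h1 hsv
      -- The level drops to `pu`. The first vertex equals this level, and the parent of the second
      -- is at most `pv < pu`, as `Below` demands.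
      refine ⟨hG.update hsv.mem (by rw [h2]; exact h1.le), pu.val, by omega,
        fun h => absurd hA h, hp, .inr ⟨hsu.mem, rfl⟩, .inl ?_⟩
      exact lt_of_le_of_lt ((hp.le rv).trans hsv.le) h1
    · exact hmove
    · exact hmove

/-- In the lock version, a root is only changed by a thread that holds its lock. -/
theorem unionStep_root (hG : Good R m.P) (hB : Bounded m.P O)
    (hO : A.splice ≠ .spliceAtomic → ∀ a b l, (a, b, l) ∈ O → l = n + 1)
    (hI : UnionInv A R m.P (O ∪ pc.obligation l) l pc)
    (hs : unionStep A u v m pc = some (pc', m')) (hA : A.union = .lock) {x : Fin n}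
    (hx : m.P x = x) (hh : pc.held ≠ some x) : m'.P x = x := by
  have hfind : ∀ f f' : FindPC n, FindInv A.find R m.P O f →
      findStep A.find m f = some (f', m') → m'.P x = x := by
    intro f f' hf hs
    refine (findStep_safe hG hB (fun hc a b l hm => ?_) hf hs).2.2.2 x hx
    rw [hO (fun h => A.allowed ⟨hc, h⟩) a b l hm]
    omega
  cases pc
  case compressU f b | compressV f b =>
    simp only [UnionInv, UnionPC.obligation, Set.union_empty] at hI
    simp only [unionStep] at hs
    split at hs <;> simp only [Option.some.injEq, Prod.mk.injEq] at hs <;> obtain ⟨rfl, rfl⟩ := hs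
    · exact hfind _ _ hI ‹_›
    · exact hx
  case acquire ru rv =>
    simp only [unionStep] at hs
    split_ifs at hs
    simp only [Option.some.injEq, Prod.mk.injEq] at hs
    obtain ⟨rfl, rfl⟩ := hs
    exact hx
  all_goals
    simp only [unionStep, Option.some.injEq, Prod.mk.injEq, reduceCtorEq] at hs
    try obtain ⟨rfl, rfl⟩ := hs
  case casLink ru rv y => exact absurd (hI.2.1.symm.trans hA) (by simp)
  case lockWrite ru rv pv =>
    have : x ≠ ru := by
      rintro rfl
      exact hh rfl
    simpa [Mem.write, this] using hx
  case oneCas ru rv v w =>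
    obtain ⟨hb, hsv, hvl, -, hsw, hwv⟩ := hI
    split_ifs with h1
    · exact (cas_shortcut hG (hB.insert (hb.1.le hG) (hb.2.le hG)) hsv.mem
        (lt_of_le_of_ne hwv (Ne.symm h1)) hsw).2.2 x hx
    · exact hx
  case spliceCas ru rv pu pv =>
    obtain ⟨hb, -, -, -, hrk, -⟩ := hI
    unfold Mem.cas
    split_ifs with h1 h2
    · have : x ≠ ru := by
        rintro rfl
        rw [← h2, hx] at hrk
        exact lt_irrefl _ hrk
      simpa [Mem.write, this] using hx
    · exact hx
    · exact hx
  all_goals exact hx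

/-- The effect of a step on the locks. -/
theorem unionStep_held (hs : unionStep A u v m pc = some (pc', m')) :
    (m'.L = m.L ∧ pc'.held = pc.held) ∨
    (∃ r, m.L r = false ∧ m'.L = Function.update m.L r true ∧ pc.held = none ∧
      pc'.held = some r) ∨
    ∃ r, m'.L = Function.update m.L r false ∧ pc.held = some r ∧ pc'.held = none := by
  have hcompress : ∀ (x : Fin n) b, (compressThenReturn A.find x b).held = none := by
    intro x b
    unfold compressThenReturn
    split <;> rfl
  have hsplice : ∀ ru rv : Fin n, (spliceStart A.splice ru rv).held = none := by
    intro ru rv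
    cases A.splice <;> rfl
  cases pc
  case compressU f b | compressV f b =>
    simp only [unionStep] at hs
    split at hs <;> simp only [Option.some.injEq, Prod.mk.injEq] at hs <;> obtain ⟨rfl, rfl⟩ := hs
    · exact .inl ⟨findStep_L ‹_›, rfl⟩
    · exact .inl ⟨rfl, rfl⟩
  case acquire ru rv =>
    simp only [unionStep] at hs
    split_ifs at hs with h
    simp only [Option.some.injEq, Prod.mk.injEq] at hs
    obtain ⟨rfl, rfl⟩ := hs
    exact .inr (.inl ⟨ru, by simpa using h, rfl, rfl, rfl⟩)
  all_goals
    simp only [unionStep, Option.some.injEq, Prod.mk.injEq, reduceCtorEq] at hs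
    try obtain ⟨rfl, rfl⟩ := hs
  case release ru rv linked => exact .inr (.inr ⟨ru, rfl, rfl, by cases linked <;> rfl⟩)
  case testV =>
    left
    split_ifs
    · split
      · exact ⟨rfl, rfl⟩
      · exact ⟨rfl, hcompress _ _⟩
    · exact ⟨rfl, rfl⟩
    · exact ⟨rfl, rfl⟩
  case rootTest =>
    left
    split_ifs
    · split <;> exact ⟨rfl, rfl⟩
    · exact ⟨rfl, hsplice _ _⟩
  case casLink =>
    refine .inl ⟨Mem.cas_L .., ?_⟩
    split_ifs
    · exact hcompress _ _
    · exact hsplice _ _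
  case lockTest =>
    left
    split_ifs <;> exact ⟨rfl, rfl⟩
  case oneCas =>
    refine .inl ⟨?_, ?_⟩
    · split_ifs
      · exact Mem.cas_L ..
      · rfl
    · split <;> rfl
  case spliceCas =>
    refine .inl ⟨?_, rfl⟩
    split_ifs
    · exact Mem.cas_L ..
    · rfl
  all_goals exact .inl ⟨rfl, rfl⟩

/-- A union is only blocked at a lock that is held. -/
theorem unionStep_blocked (hs : unionStep A u v m pc = none) :
    (∃ b, pc = .ret b) ∨ (pc.held = none ∧ ∃ r, m.L r = true) := by
  cases pc
  case ret b => exact .inl ⟨b, rfl⟩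
  case acquire ru rv =>
    simp only [unionStep] at hs
    split_ifs at hs with h
    exact .inr ⟨rfl, ru, h⟩
  case compressU | compressV =>
    simp only [unionStep] at hs
    split at hs <;> simp at hs
  all_goals simp [unionStep] at hs

end UnionStep

/-! ### Measures -/

section Measure

variable {n : ℕ} {R : Fin n → Prop} {P : Fin n → Fin n} {O : Set (Fin n × Fin n × ℕ)}
  {A : Variant} {o : FindOption} {m m' : Mem n} {l : ℕ} {u v : Fin n}

open Classical in
/-- A bound for the number of steps of a find procedure while the parents do not change. -/
noncomputable def findMeasure (R : Fin n → Prop) (P : Fin n → Fin n) : FindPC n → ℕ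
  | .naiveTest v => 3 * rank R v + 2
  | .naiveMove v => 3 * rank R v + 1
  | .parent u => 10 * rank R u + 5
  | .grandparent u v => 10 * rank R u + if v = u ∧ P u ≠ u then 8 else 4
  | .shortcut u v _ => 10 * rank R u + if v = u then 7 else 3
  | .advance u => 10 * rank R u + 2
  | .compFirst _ => 6 * n + 6
  | .compTest _ r => 3 * n + 3 + 3 * rank R r + 2
  | .compMove _ r => 3 * n + 3 + 3 * rank R r + 1
  | .compRead u _ => 3 * rank R u + 2
  | .compWrite u _ _ => 3 * rank R u + 1
  | .ret _ => 0

theorem findMeasure_start : findMeasure R P (findStart o u) ≤ 10 * n + 6 := by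
  have := rank_le (R := R) (x := u)
  cases o <;> simp only [findStart, findMeasure] <;> omega

/-- The delicate case is `v = u`, read while `u` was a root that has since been linked: the CAS
fails and splitting restarts at `u` without a drop in rank. The weight 8 instead of 4 pays for this
single retry, as the next read of `P u` yields a different vertex while `P` is fixed. -/
theorem findStep_measure {pc pc' : FindPC n} (hG : Good R m.P) (hI : FindInv o R m.P O pc)
    (hs : findStep o m pc = some (pc', m')) :
    findMeasure R m.P pc' < findMeasure R m.P pc := by
  have hrank : ∀ x, rank R x ≤ n := fun x => rank_le
  cases pc <;> simp only [findStep, Option.some.injEq, Prod.mk.injEq, reduceCtorEq] at hs <;>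
    obtain ⟨rfl, rfl⟩ := hs
  case naiveTest v => split_ifs <;> simp only [findMeasure] <;> omega
  case naiveMove v =>
    have := hG.rank_lt hI
    simp only [findMeasure]
    omega
  case parent u =>
    simp only [findMeasure]
    split_ifs with h
    · exact absurd h.1 h.2
    · omega
  case grandparent u v =>
    by_cases h : v = m.P v
    · rw [if_pos h]
      simp only [findMeasure]
      split_ifs <;> omega
    · rw [if_neg h]
      simp only [findMeasure]
      by_cases hv : v = u
      · subst hv
        rw [if_pos rfl, if_pos ⟨rfl, fun h' => h h'.symm⟩]
        omega
      · rw [if_neg hv, if_neg fun h' => hv h'.1]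
        omega
  case shortcut u v w =>
    obtain ⟨-, h, -⟩ := hI
    cases o <;> simp only [findMeasure] <;> split_ifs with hv <;>
      first
      | omega
      | (subst hv; omega)
  case advance u =>
    have := hG.rank_lt hI
    simp only [findMeasure]
    omega
  case compFirst u =>
    have := hrank u
    split_ifs <;> simp only [findMeasure] <;> omega
  case compTest u r =>
    have := hrank u
    split_ifs <;> simp only [findMeasure] <;> omega
  case compMove u r =>
    have := hG.rank_lt hI.2.2
    simp only [findMeasure]
    omega
  case compRead u r => split_ifs <;> simp only [findMeasure] <;> omega
  case compWrite u r j =>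
    have := hI.2.2.2.2
    simp only [findMeasure]
    omega

open Classical in
/-- A bound for the number of steps of a union while the parents do not change. -/
noncomputable def unionMeasure (R : Fin n → Prop) (P : Fin n → Fin n) : UnionPC n → ℕ
  | .testU ru rv => 40 * (rank R ru + rank R rv) + 20 * n + 32 + 32
  | .testV ru rv _ => 40 * (rank R ru + rank R rv) + 20 * n + 32 + 31
  | .rootTest ru rv => 40 * (rank R ru + rank R rv) + 20 * n + 32 + 30
  | .casRead ru rv => 40 * (rank R ru + rank R rv) + 20 * n + 32 + 29
  | .casLink ru rv _ => 40 * (rank R ru + rank R rv) + 20 * n + 32 + 28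
  | .acquire ru rv =>
      40 * (rank R ru + rank R rv) + 20 * n + 32 + if P ru = ru then 29 else 60
  | .lockRead ru rv =>
      40 * (rank R ru + rank R rv) + 20 * n + 32 + if P ru = ru then 28 else 59
  | .lockTest ru rv _ =>
      40 * (rank R ru + rank R rv) + 20 * n + 32 + if P ru = ru then 27 else 58
  | .lockWrite _ _ _ => 2
  | .release ru rv false => 40 * (rank R ru + rank R rv) + 20 * n + 32 + 57
  | .release _ _ true => 1
  | .oneParent ru rv => 40 * (rank R ru + rank R rv) + 20 * n + 32 + 17
  | .oneGrandparent ru rv _ => 40 * (rank R ru + rank R rv) + 20 * n + 32 + 16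
  | .oneCas ru rv _ _ => 40 * (rank R ru + rank R rv) + 20 * n + 32 + 15
  | .spliceReadU ru rv => 40 * (rank R ru + rank R rv) + 20 * n + 32 + 17
  | .spliceReadV ru rv _ => 40 * (rank R ru + rank R rv) + 20 * n + 32 + 16
  | .spliceCas ru rv _ _ => 40 * (rank R ru + rank R rv) + 20 * n + 32 + 15
  | .compressU f _ => findMeasure R P f + 10 * n + 8
  | .compressV f _ => findMeasure R P f + 1
  | .ret _ => 0

/-- The bound is the reserve built into the measure at loop points that may still start the two
final compressions. -/
theorem unionMeasure_compressThenReturn (b : Bool) :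
    unionMeasure R P (compressThenReturn A.find u b) < 20 * n + 32 := by
  unfold compressThenReturn
  split
  · simp [unionMeasure]
  · have := findMeasure_start (R := R) (P := P) (o := A.find) (u := u)
    simp only [unionMeasure]
    omega

theorem unionMeasure_spliceStart {ru rv : Fin n} (s : SpliceOption) :
    unionMeasure R P (spliceStart s ru rv) =
      40 * (rank R ru + rank R rv) + 20 * n + 32 + 17 := by
  cases s <;> rfl

/-- Every step that does not change the parents decreases the measure. -/
theorem unionStep_measure {pc pc' : UnionPC n} (hG : Good R m.P) (hI : UnionInv A R m.P O l pc)
    (hs : unionStep A u v m pc = some (pc', m')) (hP : m'.P = m.P) :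
    unionMeasure R m.P pc' < unionMeasure R m.P pc := by
  have hcompress : ∀ (x : Fin n) b,
      unionMeasure R m.P (compressThenReturn A.find x b) < 20 * n + 32 :=
    fun x b => unionMeasure_compressThenReturn b
  cases pc
  case compressU f b =>
    simp only [unionStep] at hs
    split at hs <;> simp only [Option.some.injEq, Prod.mk.injEq] at hs <;> obtain ⟨rfl, rfl⟩ := hs
    · have := findStep_measure hG hI ‹_›
      simp only [unionMeasure]
      omega
    · have := findMeasure_start (R := R) (P := m.P) (o := A.find) (u := v)
      simp only [unionMeasure]
      omega
  case compressV f b =>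
    simp only [unionStep] at hs
    split at hs <;> simp only [Option.some.injEq, Prod.mk.injEq] at hs <;> obtain ⟨rfl, rfl⟩ := hs
    · have := findStep_measure hG hI ‹_›
      simp only [unionMeasure]
      omega
    · simp only [unionMeasure]
      omega
  case acquire ru rv =>
    simp only [unionStep] at hs
    split_ifs at hs
    simp only [Option.some.injEq, Prod.mk.injEq] at hs
    obtain ⟨rfl, rfl⟩ := hs
    simp only [unionMeasure]
    split_ifs <;> omega
  all_goals
    simp only [unionStep, Option.some.injEq, Prod.mk.injEq, reduceCtorEq] at hs
    try obtain ⟨rfl, rfl⟩ := hs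
  case testV ru rv a =>
    split_ifs
    · split
      · simp only [unionMeasure]
        omega
      · refine (hcompress u false).trans_le ?_
        simp only [unionMeasure]
        omega
    · simp only [unionMeasure]
      omega
    · simp only [unionMeasure]
      omega
  case rootTest ru rv =>
    split_ifs with h
    · split <;> simp only [unionMeasure, ← h, if_true] <;> omega
    · rw [unionMeasure_spliceStart]
      simp only [unionMeasure]
      omega
  case casLink ru rv x =>
    split_ifs with h
    -- A successful link strictly lowers `P ru`, contrary to `hP`.
    · have hx := hI.2.2.2.resolve_right fun h' => h' h
      have := congrFun hP ru
      simp only [Mem.cas, if_pos h, Mem.write, Function.update_self] at this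
      rw [h] at this
      exact absurd this hx.ne
    · rw [unionMeasure_spliceStart]
      simp only [unionMeasure]
      omega
  case lockRead ru rv =>
    simp only [unionMeasure]
    split_ifs <;> omega
  case lockTest ru rv pv =>
    -- A root passes the test. The fruitless round through the lock, priced at 58 instead of 27,
    -- occurs only if `ru` has lost its root status.
    by_cases h : m.P ru = ru
    · have hx := hI.2.2.2.resolve_right fun h' => h' h
      rw [if_pos ⟨h.symm, hx⟩]
      simp only [unionMeasure]
      omega
    · rw [if_neg fun h' => h h'.1.symm]
      simp only [unionMeasure, if_neg h]
      omega
  case lockWrite ru rv pv =>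
    simp [unionMeasure]
  case release ru rv linked =>
    cases linked
    · simp [unionMeasure]
    · simp [unionMeasure]
  case oneCas ru rv v w =>
    obtain ⟨-, hsv, -, hrk, hsw, hwv⟩ := hI
    have h1 := rank_of_mem hsv.mem
    have h2 := rank_of_mem hsw.mem
    rw [Fin.le_def] at hwv
    -- The rank of the first vertex drops by at least one, and the factor 40 outweighs the restart
    -- from 15 to 32.
    split <;> simp only [unionMeasure] <;> omega
  case spliceCas ru rv pu pv =>
    have := hI.2.2.2.2.1
    simp only [unionMeasure]
    omega
  all_goals
    simp only [unionMeasure]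
    omega

end Measure

/-! ### Operations in progress -/

section Local

variable {n : ℕ} {R : Fin n → Prop} {P P' : Fin n → Fin n} {O O' : Set (Fin n × Fin n × ℕ)}
  {A : Variant} {m m' : Mem n} {l : ℕ} {p p' : Local n}

/-- The obligation of an operation in progress. -/
def Local.obligation (l : ℕ) : Local n → Set (Fin n × Fin n × ℕ)
  | .union _ _ pc => pc.obligation l
  | .find _ => ∅

/-- The lock held by an operation in progress. -/
def Local.held : Local n → Option (Fin n)
  | .union _ _ pc => pc.held
  | .find _ => none

/-- The invariant of an operation in progress. -/
def LocalInv (A : Variant) (R : Fin n → Prop) (P : Fin n → Fin n)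
    (O : Set (Fin n × Fin n × ℕ)) (l : ℕ) : Local n → Prop
  | .union _ _ pc => UnionInv A R P O l pc
  | .find pc => FindInv A.find R P O pc

/-- A bound for the number of steps of an operation while the parents do not change. -/
noncomputable def Local.measure (R : Fin n → Prop) (P : Fin n → Fin n) : Local n → ℕ
  | .union _ _ pc => unionMeasure R P pc
  | .find pc => findMeasure R P pc

theorem LocalInv.evolves (h : LocalInv A R P O l p) (hG : Good R P) (hG' : Good R P')
    (hE : Evolves R P O P' O')
    (hL : ∀ r, A.union = .lock → p.held = some r → P r = r → P' r = r) :
    LocalInv A R P' O' l p := by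
  cases p with
  | union => exact UnionInv.evolves h hG hG' hE hL
  | find => exact FindInv.evolves h hG hG' hE

theorem Local.bounded_obligation (hG : Good R P) (h : LocalInv A R P O l p) :
    Bounded P (p.obligation l) := by
  cases p with
  | union => exact UnionPC.bounded_obligation hG h
  | find => exact fun _ _ _ h => h.elim

theorem Local.level_obligation {a b : Fin n} {l' : ℕ} (h : (a, b, l') ∈ p.obligation l) :
    l' = l := by
  cases p with
  | union u v pc =>
    cases pc
    case release _ _ b => cases b <;> cases h; rfl
    all_goals cases h
    all_goals rfl
  | find => cases h

theorem Local.step_union {u v : Fin n} {pc : UnionPC n}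
    (hs : (Local.union u v pc).step A m = some (p', m')) :
    ∃ pc', p' = .union u v pc' ∧ unionStep A u v m pc = some (pc', m') := by
  simp only [Local.step, Option.map_eq_some_iff, Prod.exists, Prod.mk.injEq] at hs
  obtain ⟨pc', _, h, rfl, rfl⟩ := hs
  exact ⟨pc', rfl, h⟩

theorem Local.step_find {pc : FindPC n} (hs : (Local.find pc).step A m = some (p', m')) :
    ∃ pc', p' = .find pc' ∧ findStep A.find m pc = some (pc', m') := by
  simp only [Local.step, Option.map_eq_some_iff, Prod.exists, Prod.mk.injEq] at hs
  obtain ⟨pc', _, h, rfl, rfl⟩ := hs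
  exact ⟨pc', rfl, h⟩

theorem forest_of_compress (hO : A.splice ≠ .spliceAtomic → ∀ a b l, (a, b, l) ∈ O → l = n + 1)
    (hc : A.find = .compress) (a b : Fin n) (l : ℕ) (h : (a, b, l) ∈ O) : n < l := by
  rw [hO (fun h => A.allowed ⟨hc, h⟩) a b l h]
  omega

/-- One step of an operation; `O` are the obligations of the other threads. -/
theorem Local.step_safe (hG : Good R m.P) (hB : Bounded m.P O)
    (hO : A.splice ≠ .spliceAtomic → ∀ a b l, (a, b, l) ∈ O → l = n + 1) (hl : l ≤ n + 1)
    (hl' : A.splice ≠ .spliceAtomic → l = n + 1)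
    (hI : LocalInv A R m.P (O ∪ p.obligation l) l p) (hs : p.step A m = some (p', m')) :
    Good R m'.P ∧ ∃ l' ≤ n + 1, (A.splice ≠ .spliceAtomic → l' = n + 1) ∧
      Preserves R m.P (O ∪ p.obligation l) m'.P (O ∪ p'.obligation l') ∧
      LocalInv A R m'.P (O ∪ p'.obligation l') l' p' := by
  cases p with
  | union u v pc =>
    obtain ⟨pc', rfl, h⟩ := Local.step_union hs
    exact unionStep_safe hG hB hO hl hl' hI h
  | find pc =>
    obtain ⟨pc', rfl, h⟩ := Local.step_find hs
    simp only [Local.obligation, LocalInv, Set.union_empty] at hI ⊢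
    have := findStep_safe hG hB (forest_of_compress hO) hI h
    exact ⟨this.1, l, hl, hl', this.2.1, this.2.2.1⟩

theorem Local.step_root (hG : Good R m.P) (hB : Bounded m.P O)
    (hO : A.splice ≠ .spliceAtomic → ∀ a b l, (a, b, l) ∈ O → l = n + 1)
    (hI : LocalInv A R m.P (O ∪ p.obligation l) l p) (hs : p.step A m = some (p', m'))
    (hA : A.union = .lock) {x : Fin n} (hx : m.P x = x) (hh : p.held ≠ some x) :
    m'.P x = x := by
  cases p with
  | union u v pc =>
    obtain ⟨pc', rfl, h⟩ := Local.step_union hs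
    exact unionStep_root hG hB hO hI h hA hx hh
  | find pc =>
    obtain ⟨pc', rfl, h⟩ := Local.step_find hs
    simp only [Local.obligation, LocalInv, Set.union_empty] at hI
    exact (findStep_safe hG hB (forest_of_compress hO) hI h).2.2.2 x hx

theorem Local.step_held (hs : p.step A m = some (p', m')) :
    (m'.L = m.L ∧ p'.held = p.held) ∨
    (∃ r, m.L r = false ∧ m'.L = Function.update m.L r true ∧ p.held = none ∧
      p'.held = some r) ∨
    ∃ r, m'.L = Function.update m.L r false ∧ p.held = some r ∧ p'.held = none := by
  cases p with
  | union u v pc =>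
    obtain ⟨pc', rfl, h⟩ := Local.step_union hs
    exact unionStep_held h
  | find pc =>
    obtain ⟨pc', rfl, h⟩ := Local.step_find hs
    exact .inl ⟨findStep_L h, rfl⟩

theorem Local.step_blocked (hs : p.step A m = none) :
    p.held = none ∧ ((∃ r, p.result = some r) ∨ ∃ r, m.L r = true) := by
  cases p with
  | union u v pc =>
    rw [Local.step, Option.map_eq_none_iff] at hs
    rcases unionStep_blocked hs with ⟨b, rfl⟩ | h
    · exact ⟨rfl, .inl ⟨_, rfl⟩⟩
    · exact ⟨h.1, .inr h.2⟩
  | find pc =>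
    rw [Local.step, Option.map_eq_none_iff] at hs
    refine ⟨rfl, .inl ?_⟩
    cases pc
    case ret r => exact ⟨_, rfl⟩
    all_goals simp [findStep] at hs

theorem Local.step_measure (hG : Good R m.P) (hI : LocalInv A R m.P O l p)
    (hs : p.step A m = some (p', m')) (hP : m'.P = m.P) :
    p'.measure R m.P < p.measure R m.P := by
  cases p with
  | union u v pc =>
    obtain ⟨pc', rfl, h⟩ := Local.step_union hs
    exact unionStep_measure hG hI h hP
  | find pc =>
    obtain ⟨pc', rfl, h⟩ := Local.step_find hs
    exact findStep_measure hG hI h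

theorem Local.of_result {r : Res n} (h : p.result = some r) :
    p.obligation l = ∅ ∧ p.held = none ∧
      ((∃ u v b, p = .union u v (.ret b) ∧ r = .union b) ∨
        ∃ x, p = .find (.ret x) ∧ r = .find x) := by
  unfold Local.result at h
  split at h
  · exact ⟨rfl, rfl, .inl ⟨_, _, _, rfl, (Option.some.inj h).symm⟩⟩
  · exact ⟨rfl, rfl, .inr ⟨_, rfl, (Option.some.inj h).symm⟩⟩
  · cases h

theorem Op.start_inv (o : Op n) : LocalInv A R P O (n + 1) (o.start A) := by
  cases o with
  | union u v => exact ⟨.of_succ, .of_succ⟩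
  | find u => exact findInv_start u

theorem Op.start_held (o : Op n) : (o.start A).held = none := by
  cases o <;> rfl

end Local

/-! ### Configurations -/

section Config

variable {ι : Type*} {n : ℕ} {R : Fin n → Prop} {A : Variant} {c c' : Config ι n}
  {lev : ι → ℕ}

/-- The obligation of a thread. -/
def threadObligation (l : ℕ) : Option (Local n) → Set (Fin n × Fin n × ℕ)
  | none => ∅
  | some p => p.obligation l

/-- The lock held by a thread. -/
def threadHeld (p : Option (Local n)) : Option (Fin n) := p.bind Local.held

/-- The obligations of all threads, where `lev` gives their levels. -/
def Config.obligations (c : Config ι n) (lev : ι → ℕ) : Set (Fin n × Fin n × ℕ) :=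
  {o | ∃ t, o ∈ threadObligation (lev t) (c.thread t)}

/-- The obligations of all threads but `t`. -/
def Config.others (c : Config ι n) (lev : ι → ℕ) (t : ι) : Set (Fin n × Fin n × ℕ) :=
  {o | ∃ t' ≠ t, o ∈ threadObligation (lev t') (c.thread t')}

/-- The invariant of concurrent executions. -/
structure Inv (A : Variant) (R : Fin n → Prop) (lev : ι → ℕ) (c : Config ι n) : Prop where
  good : Good R c.mem.P
  level_le : ∀ t, lev t ≤ n + 1
  level_eq : A.splice ≠ .spliceAtomic → ∀ t, lev t = n + 1
  locals : ∀ t p, c.thread t = some p → LocalInv A R c.mem.P (c.obligations lev) (lev t) p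
  lock_iff : ∀ r, c.mem.L r = true ↔ ∃ t, threadHeld (c.thread t) = some r
  lock_unique : ∀ t t' r, threadHeld (c.thread t) = some r →
    threadHeld (c.thread t') = some r → t = t'

theorem Config.obligations_eq (c : Config ι n) (lev : ι → ℕ) (t : ι) :
    c.obligations lev = c.others lev t ∪ threadObligation (lev t) (c.thread t) := by
  ext o
  constructor
  · rintro ⟨t', h⟩
    by_cases ht : t' = t
    · subst ht
      exact .inr h
    · exact .inl ⟨t', ht, h⟩
  · rintro (⟨t', -, h⟩ | h)
    · exact ⟨t', h⟩
    · exact ⟨t, h⟩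

theorem Config.obligations_update [DecidableEq ι] (c : Config ι n) (lev : ι → ℕ) (t : ι)
    (l : ℕ) (p : Option (Local n)) (m : Mem n) :
    (⟨m, Function.update c.thread t p⟩ : Config ι n).obligations (Function.update lev t l) =
      c.others lev t ∪ threadObligation l p := by
  rw [Config.obligations_eq _ _ t]
  simp only [Function.update_self]
  congr 1
  ext o
  refine exists_congr fun t' => and_congr_right fun ht => ?_
  simp [ht]

namespace Inv

theorem bounded_others (h : Inv A R lev c) (t : ι) : Bounded c.mem.P (c.others lev t) := by
  rintro a b l ⟨t', -, hm⟩
  cases hp : c.thread t' with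
  | none => rw [hp] at hm; cases hm
  | some p =>
    rw [hp] at hm
    exact Local.bounded_obligation h.good (h.locals t' p hp) a b l hm

theorem level_others (h : Inv A R lev c) (t : ι) (hA : A.splice ≠ .spliceAtomic) (a b : Fin n)
    (l : ℕ) (hm : (a, b, l) ∈ c.others lev t) : l = n + 1 := by
  obtain ⟨t', -, hm⟩ := hm
  cases hp : c.thread t' with
  | none => rw [hp] at hm; cases hm
  | some p =>
    rw [hp] at hm
    exact (Local.level_obligation hm).trans (h.level_eq hA t')

/-- Common frame for internal steps, invocations and responses. The other threads survive because
the change is an evolution and because a root they guard by a lock is not guarded by `t`, hence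
untouched by `hroot`. -/
theorem update [DecidableEq ι] (h : Inv A R lev c) {t : ι} {l : ℕ} {p : Option (Local n)}
    {m : Mem n} (hG : Good R m.P) (hl : l ≤ n + 1) (hl' : A.splice ≠ .spliceAtomic → l = n + 1)
    (hE : Evolves R c.mem.P (c.obligations lev) m.P (c.others lev t ∪ threadObligation l p))
    (hp : ∀ q, p = some q → LocalInv A R m.P (c.others lev t ∪ threadObligation l p) l q)
    (hroot : ∀ x, A.union = .lock → c.mem.P x = x → threadHeld (c.thread t) ≠ some x →
      m.P x = x)
    (hL : (m.L = c.mem.L ∧ threadHeld p = threadHeld (c.thread t)) ∨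
      (∃ r, c.mem.L r = false ∧ m.L = Function.update c.mem.L r true ∧
        threadHeld (c.thread t) = none ∧ threadHeld p = some r) ∨
      ∃ r, m.L = Function.update c.mem.L r false ∧ threadHeld (c.thread t) = some r ∧
        threadHeld p = none) :
    Inv A R (Function.update lev t l) ⟨m, Function.update c.thread t p⟩ := by
  have hheld : ∀ t', threadHeld (Function.update c.thread t p t') =
      if t' = t then threadHeld p else threadHeld (c.thread t') := by
    intro t'
    by_cases ht : t' = t
    · subst ht; simp
    · simp [ht]
  refine ⟨hG, fun t' => ?_, fun hA t' => ?_, fun t' q hq => ?_, fun r => ?_,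
    fun t₁ t₂ r h₁ h₂ => ?_⟩
  · by_cases ht : t' = t
    · subst ht; simpa using hl
    · simpa [ht] using h.level_le t'
  · by_cases ht : t' = t
    · subst ht; simpa using hl' hA
    · simpa [ht] using h.level_eq hA t'
  · rw [Config.obligations_update]
    by_cases ht : t' = t
    · subst ht
      simp only [Function.update_self] at hq ⊢
      exact hp q hq
    · simp only [Function.update_of_ne ht] at hq ⊢
      refine (h.locals t' q hq).evolves h.good hG hE fun r hA hr hx => hroot r hA hx fun hr' => ?_
      exact ht (h.lock_unique t' t r (by rw [hq]; exact hr) hr')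
  · simp only [hheld]
    rcases hL with ⟨h1, h2⟩ | ⟨r', h1, h2, h3, h4⟩ | ⟨r', h1, h2, h3⟩
    · rw [h1, h.lock_iff]
      refine exists_congr fun t' => ?_
      split_ifs with ht
      · rw [ht, h2]
      · rfl
    · rw [h2]
      by_cases hr : r = r'
      · subst hr
        simp only [Function.update_self, true_iff]
        exact ⟨t, by rw [if_pos rfl, h4]⟩
      · rw [Function.update_of_ne hr, h.lock_iff]
        refine exists_congr fun t' => ?_
        split_ifs with ht
        · rw [ht, h3, h4]
          simp [Ne.symm hr]
        · rfl
    · rw [h1]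
      by_cases hr : r = r'
      · subst hr
        simp only [Function.update_self, Bool.false_eq_true, false_iff, not_exists]
        intro t'
        split_ifs with ht
        · simp [h3]
        · exact fun h' => ht (h.lock_unique _ _ _ h' h2)
      · rw [Function.update_of_ne hr, h.lock_iff]
        refine exists_congr fun t' => ?_
        split_ifs with ht
        · rw [ht, h2, h3]
          simp [Ne.symm hr]
        · rfl
  · simp only [hheld] at h₁ h₂
    have key : threadHeld p = some r → ∀ t', t' ≠ t → threadHeld (c.thread t') ≠ some r := by
      intro hpr t' ht' hr
      rcases hL with ⟨-, h2⟩ | ⟨r', h1, -, -, h4⟩ | ⟨r', -, -, h3⟩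
      · exact ht' (h.lock_unique _ _ _ hr (h2 ▸ hpr))
      · obtain rfl : r' = r := Option.some.inj (h4.symm.trans hpr)
        have := (h.lock_iff r').2 ⟨t', hr⟩
        rw [h1] at this
        cases this
      · rw [h3] at hpr
        cases hpr
    split_ifs at h₁ h₂ with ht₁ ht₂ ht₂
    · exact ht₁.trans ht₂.symm
    · exact absurd h₂ (key h₁ _ ht₂)
    · exact absurd h₁ (key h₂ _ ht₁)
    · exact h.lock_unique _ _ _ h₁ h₂

theorem step [DecidableEq ι] (h : Inv A R lev c) {t : ι} {p p' : Local n} {m' : Mem n}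
    (hp : c.thread t = some p) (hs : p.step A c.mem = some (p', m')) :
    ∃ lev', Inv A R lev' ⟨m', Function.update c.thread t (some p')⟩ ∧
      Preserves R c.mem.P (c.obligations lev) m'.P
        ((⟨m', Function.update c.thread t (some p')⟩ : Config ι n).obligations lev') := by
  have hO := c.obligations_eq lev t
  rw [hp] at hO
  have hI := h.locals t p hp
  rw [hO] at hI
  obtain ⟨hG, l, hl, hl', hP, hI'⟩ := Local.step_safe h.good (h.bounded_others t)
    (h.level_others t) (h.level_le t) (fun hA => h.level_eq hA t) hI hs
  refine ⟨Function.update lev t l, h.update hG hl hl' ?_ ?_ ?_ ?_, ?_⟩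
  · rw [hO]
    exact hP.toEvolves
  · rintro _ ⟨⟩
    exact hI'
  · intro x hA hx hh
    rw [hp] at hh
    exact Local.step_root h.good (h.bounded_others t) (h.level_others t) hI hs hA hx hh
  · rw [hp]
    exact Local.step_held hs
  · rw [Config.obligations_update, hO]
    exact hP

theorem internalStep [DecidableEq ι] (h : Inv A R lev c) (hs : InternalStep A c c') :
    ∃ lev', Inv A R lev' c' ∧
      Preserves R c.mem.P (c.obligations lev) c'.mem.P (c'.obligations lev') := by
  obtain ⟨t, p, p', m', hp, hs, rfl⟩ := hs
  exact h.step hp hs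

theorem steps [DecidableEq ι] (h : Inv A R lev c)
    (hs : Relation.ReflTransGen (InternalStep A) c c') :
    ∃ lev', Inv A R lev' c' ∧
      Preserves R c.mem.P (c.obligations lev) c'.mem.P (c'.obligations lev') := by
  induction hs with
  | refl => exact ⟨lev, h, .refl⟩
  | tail _ hs ih =>
    obtain ⟨lev', h', hP⟩ := ih
    obtain ⟨lev'', h'', hP'⟩ := h'.internalStep hs
    exact ⟨lev'', h'', hP.trans hP'⟩

/-! ### Termination -/

/-- The measure of a thread. -/
noncomputable def _root_.RemUF.threadMeasure (R : Fin n → Prop) (P : Fin n → Fin n) :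
    Option (Local n) → ℕ
  | none => 0
  | some p => p.measure R P

/-- Steps decrease the sum of the parents, or else the sum of the measures of the threads. -/
noncomputable def _root_.RemUF.Config.measure [Fintype ι] (R : Fin n → Prop) (c : Config ι n) :
    ℕ ×ₗ ℕ :=
  toLex (∑ x, (c.mem.P x).val, ∑ t, threadMeasure R c.mem.P (c.thread t))

/-- A step can raise the measures of other threads only by changing `P`, and then the first
component drops because parents never increase. -/
theorem measure_lt [DecidableEq ι] [Fintype ι] (h : Inv A R lev c)
    (hs : InternalStep A c c') : c'.measure R < c.measure R := by
  obtain ⟨lev', h', hP⟩ := h.internalStep hs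
  obtain ⟨t, p, p', m', hp, hs, rfl⟩ := hs
  rw [Config.measure, Config.measure, Prod.Lex.toLex_lt_toLex]
  by_cases hm : m'.P = c.mem.P
  · refine .inr ⟨by simp [hm], ?_⟩
    refine Finset.sum_lt_sum (fun t' _ => ?_) ⟨t, Finset.mem_univ t, ?_⟩
    · by_cases ht : t' = t
      · subst ht
        simpa [hm, hp, threadMeasure] using
          (Local.step_measure h.good (h.locals t' p hp) hs hm).le
      · simp [hm, ht]
    · simpa [hm, hp, threadMeasure] using Local.step_measure h.good (h.locals t p hp) hs hm
  · left
    change ∑ x, (m'.P x).val < ∑ x, (c.mem.P x).val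
    refine Finset.sum_lt_sum (fun x _ => Fin.le_def.1 (hP.le x)) ?_
    by_contra! hx
    exact hm (funext fun x => le_antisymm (hP.le x) (hx x (Finset.mem_univ x)))

/-- The lexicographic order is well-founded, which excludes infinite runs. In a stuck state an
unfinished thread waits for a lock whose holder is stuck as well; but operations without a step hold
no lock. -/
theorem terminates [DecidableEq ι] [Finite ι] (h : Inv A R lev c) : Terminates A c := by
  have := Fintype.ofFinite ι
  constructor
  · rintro ⟨f, rfl, hf⟩
    have hinv : ∀ k, ∃ lev, Inv A R lev (f k) := by
      intro k
      induction k with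
      | zero => exact ⟨lev, h⟩
      | succ k ih =>
        obtain ⟨lev, h⟩ := ih
        obtain ⟨lev', h', -⟩ := h.internalStep (hf k)
        exact ⟨lev', h'⟩
    refine not_strictAnti_of_wellFoundedLT (fun k => (f k).measure R)
      (strictAnti_nat_of_succ_lt fun k => ?_)
    obtain ⟨lev, h⟩ := hinv k
    exact h.measure_lt (hf k)
  · intro c' hc
    obtain ⟨lev', h', -⟩ := h.steps hc
    by_contra! hcon
    obtain ⟨hfin, hstuck⟩ := hcon
    have hnone : ∀ t p, c'.thread t = some p → p.step A c'.mem = none := by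
      intro t p hp
      by_contra hne
      obtain ⟨⟨p', m'⟩, hs⟩ := Option.ne_none_iff_exists'.1 hne
      exact hstuck _ ⟨t, p, p', m', hp, hs, rfl⟩
    refine hfin fun t p hp => (Local.step_blocked (hnone t p hp)).2.resolve_right ?_
    rintro ⟨r, hr⟩
    obtain ⟨t', ht'⟩ := (h'.lock_iff r).1 hr
    cases hq : c'.thread t' with
    | none => simp [hq, threadHeld] at ht'
    | some q =>
      have := (Local.step_blocked (hnone t' q hq)).1
      simp [hq, threadHeld, this] at ht'

end Inv

end Config

/-! ### The invariant at the start, at invocations and at responses. -/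

section Config

variable {ι : Type*} {n : ℕ} {R : Fin n → Prop} {A : Variant} {c c' : Config ι n}
  {lev : ι → ℕ}

namespace Inv

theorem initial {C₀ : Fin n → Fin n} (hC₀ : ∀ v, C₀ (C₀ v) = C₀ v) {c : Config ι n}
    (hm : c.mem = ⟨C₀, fun _ => false⟩)
    (ht : ∀ t p, c.thread t = some p → ∃ o : Op n, p = o.start A) :
    Inv A (fun x => C₀ x = x) (fun _ => n + 1) c := by
  have hheld : ∀ t, threadHeld (c.thread t) = none := by
    intro t
    cases hp : c.thread t with
    | none => rfl
    | some p =>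
      obtain ⟨o, rfl⟩ := ht t p hp
      exact Op.start_held o
  refine ⟨?_, fun _ => le_rfl, fun _ _ => rfl, fun t p hp => ?_, fun r => ?_, fun t _ r h => ?_⟩
  · rw [hm]
    exact ⟨hC₀, fun x hx => hx.le⟩
  · obtain ⟨o, rfl⟩ := ht t p hp
    exact Op.start_inv o
  · simp [hm, hheld]
  · simp [hheld] at h

theorem invoke [DecidableEq ι] (h : Inv A R lev c) {t : ι} (ht : c.thread t = none) (o : Op n) :
    Inv A R (Function.update lev t (n + 1))
      ⟨c.mem, Function.update c.thread t (some (o.start A))⟩ := by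
  refine h.update h.good le_rfl (fun _ => rfl) ⟨fun _ => le_rfl, fun k x y hc => ?_,
    fun _ => Conn.refl _⟩ ?_ (fun _ _ hx _ => hx) (.inl ⟨rfl, ?_⟩)
  · rw [c.obligations_eq lev t, ht] at hc
    refine hc.of_obligations fun a b l hm _ => .inl (hm.resolve_right fun h => ?_)
    exact h.elim
  · rintro _ ⟨⟩
    exact Op.start_inv o
  · rw [ht]
    exact Op.start_held o

theorem respond [DecidableEq ι] (h : Inv A R lev c) {t : ι} {p : Local n} {r : Res n}
    (ht : c.thread t = some p) (hr : p.result = some r) :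
    Inv A R lev ⟨c.mem, Function.update c.thread t none⟩ ∧
      (⟨c.mem, Function.update c.thread t none⟩ : Config ι n).obligations lev =
        c.obligations lev := by
  obtain ⟨ho, hh, -⟩ := Local.of_result (l := lev t) hr
  have hO : c.obligations lev = c.others lev t ∪ threadObligation (lev t) none := by
    rw [c.obligations_eq lev t, ht]
    simp only [threadObligation, ho]
  constructor
  · have := h.update (t := t) (l := lev t) (p := none) h.good (h.level_le t)
      (fun hA => h.level_eq hA t) (hO ▸ .refl) (by simp) (fun _ _ hx _ => hx)
      (.inl ⟨rfl, by rw [ht]; exact hh.symm⟩)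
    rwa [Function.update_eq_self] at this
  · rw [hO, ← c.obligations_update, Function.update_eq_self]

end Inv

/-! ### Linearizability -/

/-- The elements `x` and `y` have the same label, or a union of them is in progress. -/
def Joined (s : Fin n → Fin n) (c : Config ι n) (x y : Fin n) : Prop :=
  s x = s y ∨ ∃ t pc, c.thread t = some (.union x y pc)

/-- The state `s` of the sequential object, to which every operation is applied at its response,
and the status `st` of the threads correspond to the configuration `c`. -/
structure Simulates (A : Variant) (R : Fin n → Prop) (lev : ι → ℕ) (c : Config ι n)
    (s : Fin n → Fin n) (st : ι → Status (Op n) (Res n)) : Prop where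
  inv : Inv A R lev c
  idle : ∀ t, c.thread t = none → st t = .idle
  union : ∀ t u v pc, c.thread t = some (.union u v pc) → st t = .pending (.union u v)
  find : ∀ t pc, c.thread t = some (.find pc) →
    ∃ u, st t = .pending (.find u) ∧ FindTrack (fun x => s x = s u) c.mem.P pc
  phase : ∀ t t' u v pc pc', c.thread t = some (.union u v pc) →
    c.thread t' = some (.find pc') → False
  conn : ∀ x y, Conn R c.mem.P (c.obligations lev) (n + 1) x y ↔
    Relation.EqvGen (Joined s c) x y
  label_idem : ∀ x, s (s x) = s x
  label_mem : ∀ x, R (s x)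
  label_le : ∀ x, R x → s x ≤ x

/-- The labeling after a union. -/
def mergeLabels (s : Fin n → Fin n) (u v x : Fin n) : Fin n :=
  if s x = s u ∨ s x = s v then min (s u) (s v) else s x

namespace Simulates

variable {s : Fin n → Fin n} {st : ι → Status (Op n) (Res n)} {t : ι}

theorem conn_parent (h : Simulates A R lev c s st) (x : Fin n) :
    Relation.EqvGen (Joined s c) x (c.mem.P x) :=
  (h.conn _ _).1 (Conn.parent (rank_le.trans (Nat.le_succ n)))

/-- A find in progress excludes unions, so only equality of labels generates the relation. -/
theorem joined_of_find (h : Simulates A R lev c s st) {pc : FindPC n}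
    (ht : c.thread t = some (.find pc)) {x y : Fin n} (hxy : Relation.EqvGen (Joined s c) x y) :
    s x = s y := by
  refine eqvGen_le (s := fun x y => s x = s y) ⟨fun _ => rfl, fun h => h.symm,
    fun h h' => h.trans h'⟩ ?_ hxy
  rintro x y (hs | ⟨t', pc', ht'⟩)
  · exact hs
  · exact (h.phase _ _ _ _ _ _ ht' ht).elim

theorem obligations_of_find (h : Simulates A R lev c s st) {pc : FindPC n}
    (ht : c.thread t = some (.find pc)) : c.obligations lev = ∅ := by
  ext o
  simp only [Set.mem_empty_iff_false, iff_false]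
  rintro ⟨t', hm⟩
  cases hp : c.thread t' with
  | none => rw [hp] at hm; exact hm
  | some p =>
    rw [hp] at hm
    cases p with
    | union => exact h.phase _ _ _ _ _ _ hp ht
    | find => exact hm

theorem initial {C₀ : Fin n → Fin n} (hC₀ : ∀ v, C₀ (C₀ v) = C₀ v) :
    Simulates A (fun x => C₀ x = x) (fun _ => n + 1) (idleConfig ι C₀) C₀
      (fun _ => Status.idle) where
  inv := .initial hC₀ rfl (by simp [idleConfig])
  idle _ _ := rfl
  union := by simp [idleConfig]
  find := by simp [idleConfig]
  phase := by simp [idleConfig]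
  conn x y := by
    constructor
    · refine eqvGen_le (Relation.EqvGen.is_equivalence _) ?_
      rintro _ _ (⟨_, -⟩ | ⟨a, b, l, ⟨_, hm⟩, -⟩)
      · exact .rel _ _ (.inl (hC₀ _).symm)
      · exact hm.elim
    · refine eqvGen_le Conn.equivalence ?_
      rintro x y (hs | ⟨t, pc, ht⟩)
      · have key : ∀ x, Conn (fun x => C₀ x = x) C₀ ((idleConfig ι C₀).obligations fun _ => n + 1)
            (n + 1) x (C₀ x) := fun x => Conn.parent (rank_le.trans (Nat.le_succ n))
        exact (key x).trans (hs ▸ (key y).symm)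
      · cases ht
  label_idem := hC₀
  label_mem := hC₀
  label_le _ hx := hx.le

/-- The new obligation joins the parents of `u` and `v`, the new abstract pair joins `u` and `v`
themselves; at level `n + 1` both have the same effect, as each vertex is linked with its parent. -/
theorem invoke_union [DecidableEq ι] (h : Simulates A R lev c s st)
    (ht : c.thread t = none) (u v : Fin n)
    (hphase : ∀ t' p, c.thread t' = some p → (Op.union u v).SameType p) :
    Simulates A R (Function.update lev t (n + 1))
      ⟨c.mem, Function.update c.thread t (some ((Op.union u v).start A))⟩ s
      (Function.update st t (.pending (.union u v))) := by
  have hO := c.obligations_eq lev t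
  rw [ht] at hO
  have hO' := c.obligations_update lev t (n + 1) (some ((Op.union u v).start A)) c.mem
  have hnofind : ∀ t' pc, c.thread t' ≠ some (.find pc) := fun t' pc hp => hphase t' _ hp
  have hle : ∀ x y, Conn R c.mem.P (c.obligations lev) (n + 1) x y →
      Conn R c.mem.P ((⟨c.mem, Function.update c.thread t (some ((Op.union u v).start A))⟩ :
        Config ι n).obligations (Function.update lev t (n + 1))) (n + 1) x y := by
    intro x y hc
    rw [hO] at hc
    rw [hO']
    exact hc.of_obligations fun a b l hm _ => .inl (hm.resolve_right fun h => h)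
  have hparent : ∀ x (O : Set (Fin n × Fin n × ℕ)), Conn R c.mem.P O (n + 1) x (c.mem.P x) :=
    fun x O => Conn.parent (rank_le.trans (Nat.le_succ n))
  have hjoin : ∀ x y, Relation.EqvGen (Joined s c) x y → Relation.EqvGen (Joined s
      ⟨c.mem, Function.update c.thread t (some ((Op.union u v).start A))⟩) x y := by
    intro x y
    refine eqvGen_le (Relation.EqvGen.is_equivalence _) ?_
    rintro x y (hs | ⟨t', pc, ht'⟩)
    · exact .rel _ _ (.inl hs)
    refine .rel _ _ (.inr ⟨t', pc, ?_⟩)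
    have : t' ≠ t := by
      rintro rfl
      rw [ht] at ht'
      cases ht'
    simpa [this] using ht'
  refine ⟨h.inv.invoke ht _, fun t' ht' => ?_, fun t' u' v' pc ht' => ?_, fun t' pc ht' => ?_,
    fun t₁ t₂ u' v' pc pc' _ h₂ => ?_, fun x y => ⟨?_, ?_⟩, h.label_idem, h.label_mem,
    h.label_le⟩
  · by_cases hne : t' = t
    · subst hne
      simp at ht'
    · simp only [Function.update_of_ne hne] at ht' ⊢
      exact h.idle t' ht'
  · by_cases hne : t' = t
    · subst hne
      simp only [Function.update_self, Op.start, Option.some.injEq, Local.union.injEq] at ht' ⊢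
      rw [ht'.1, ht'.2.1]
    · simp only [Function.update_of_ne hne] at ht' ⊢
      exact h.union t' u' v' pc ht'
  · by_cases hne : t' = t
    · subst hne
      simp [Op.start] at ht'
    · simp only [Function.update_of_ne hne] at ht'
      exact (hnofind _ _ ht').elim
  · by_cases hne : t₂ = t
    · subst hne
      simp [Op.start] at h₂
    · simp only [Function.update_of_ne hne] at h₂
      exact (hnofind _ _ h₂).elim
  · refine eqvGen_le (Relation.EqvGen.is_equivalence _) ?_
    rintro _ _ (⟨_, -⟩ | ⟨a, b, l, hm, hl⟩)
    · exact hjoin _ _ (h.conn_parent _)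
    · rw [hO'] at hm
      rcases hm with hm | hm
      · exact hjoin _ _ ((h.conn _ _).1 (Conn.pair (by rw [hO]; exact .inl hm) hl))
      · obtain ⟨⟩ := hm
        refine .trans _ _ _ (.symm _ _ (hjoin _ _ (h.conn_parent u)))
          (.trans _ _ _ (.rel _ _ (.inr ⟨t, .testU u v, ?_⟩)) (hjoin _ _ (h.conn_parent v)))
        simp [Op.start]
  · refine eqvGen_le Conn.equivalence ?_
    rintro x y (hs | ⟨t', pc, ht'⟩)
    · exact hle _ _ ((h.conn _ _).2 (.rel _ _ (.inl hs)))
    · by_cases hne : t' = t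
      · subst hne
        simp only [Function.update_self, Op.start, Option.some.injEq, Local.union.injEq] at ht'
        obtain ⟨rfl, rfl, -⟩ := ht'
        refine (hparent u _).trans (.trans (.pair (l := n + 1) ?_ le_rfl) (hparent v _).symm)
        rw [hO']
        exact .inr rfl
      · simp only [Function.update_of_ne hne] at ht'
        exact hle _ _ ((h.conn _ _).2 (.rel _ _ (.inr ⟨t', pc, ht'⟩)))

theorem invoke_find [DecidableEq ι] (h : Simulates A R lev c s st)
    (ht : c.thread t = none) (u : Fin n)
    (hphase : ∀ t' p, c.thread t' = some p → (Op.find u).SameType p) :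
    Simulates A R (Function.update lev t (n + 1))
      ⟨c.mem, Function.update c.thread t (some ((Op.find u).start A))⟩ s
      (Function.update st t (.pending (.find u))) := by
  have hO : (⟨c.mem, Function.update c.thread t (some ((Op.find u).start A))⟩ :
      Config ι n).obligations (Function.update lev t (n + 1)) = c.obligations lev := by
    rw [c.obligations_update, c.obligations_eq lev t, ht]
    rfl
  have hnounion : ∀ t' u v pc, c.thread t' ≠ some (.union u v pc) :=
    fun t' u v pc hp => hphase t' _ hp
  have hnounion' : ∀ t' x y pc, Function.update c.thread t (some ((Op.find u).start A)) t' ≠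
      some (.union x y pc) := by
    intro t' x y pc
    by_cases hne : t' = t
    · subst hne
      simp [Op.start]
    · simpa [hne] using hnounion t' x y pc
  have hjoin : Joined s ⟨c.mem, Function.update c.thread t (some ((Op.find u).start A))⟩ =
      Joined s c := by
    funext x y
    simp [Joined, hnounion, hnounion']
  refine ⟨h.inv.invoke ht _, fun t' ht' => ?_, fun t' u' v' pc ht' => ?_, fun t' pc ht' => ?_,
    fun t₁ t₂ u' v' pc pc' h₁ _ => hnounion' _ _ _ _ h₁, fun x y => ?_, h.label_idem,
    h.label_mem, h.label_le⟩
  · by_cases hne : t' = t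
    · subst hne
      simp at ht'
    · simp only [Function.update_of_ne hne] at ht' ⊢
      exact h.idle t' ht'
  · exact (hnounion' _ _ _ _ ht').elim
  · by_cases hne : t' = t
    · subst hne
      simp only [Function.update_self, Op.start, Option.some.injEq, Local.find.injEq] at ht' ⊢
      subst ht'
      exact ⟨u, rfl, findTrack_start (K := fun x => s x = s u) rfl⟩
    · simp only [Function.update_of_ne hne] at ht' ⊢
      exact h.find t' pc ht'
  · rw [hO, hjoin]
    exact h.conn x y

/-- Internal steps change neither the operands of the unions in progress nor the connectivity at
level `n + 1`, so the abstract state can stay as it is. -/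
theorem internalStep [DecidableEq ι] (h : Simulates A R lev c s st) (hs : InternalStep A c c') :
    ∃ lev', Simulates A R lev' c' s st := by
  obtain ⟨t, p, p', m', hp, hs, rfl⟩ := hs
  obtain ⟨lev', hI, hP⟩ := h.inv.step hp hs
  have hconn : ∀ x y, Conn R m'.P ((⟨m', Function.update c.thread t (some p')⟩ :
      Config ι n).obligations lev') (n + 1) x y ↔ Relation.EqvGen (Joined s c) x y :=
    fun x y => ⟨fun hc => (h.conn x y).1 (hP.back x y hc),
      fun hc => hP.conn _ x y ((h.conn x y).2 hc)⟩
  refine ⟨lev', ?_⟩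
  cases p with
  | union u v pc =>
    obtain ⟨pc', rfl, -⟩ := Local.step_union hs
    have hnofind : ∀ t' pc, Function.update c.thread t (some (.union u v pc')) t' ≠
        some (.find pc) := by
      intro t' pc₁ ht'
      by_cases hne : t' = t
      · subst hne
        simp at ht'
      · simp only [Function.update_of_ne hne] at ht'
        exact h.phase _ _ _ _ _ _ hp ht'
    have hpair : ∀ t' x y, (∃ pc₁, Function.update c.thread t (some (.union u v pc')) t' =
        some (.union x y pc₁)) ↔ ∃ pc₁, c.thread t' = some (.union x y pc₁) := by
      intro t' x y
      by_cases hne : t' = t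
      · subst hne
        simp [hp]
      · simp [hne]
    have hjoin : Joined s ⟨m', Function.update c.thread t (some (.union u v pc'))⟩ =
        Joined s c := by
      funext x y
      simp only [Joined, hpair]
    refine ⟨hI, fun t' ht' => ?_, fun t' u' v' pc₁ ht' => ?_, fun t' pc₁ ht' => ?_,
      fun t₁ t₂ u' v' pc₁ pc₂ _ h₂ => hnofind _ _ h₂, fun x y => ?_, h.label_idem,
      h.label_mem, h.label_le⟩
    · by_cases hne : t' = t
      · subst hne
        simp at ht'
      · simp only [Function.update_of_ne hne] at ht'
        exact h.idle t' ht'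
    · obtain ⟨pc₂, h₂⟩ := (hpair t' u' v').1 ⟨pc₁, ht'⟩
      exact h.union _ _ _ _ h₂
    · exact (hnofind _ _ ht').elim
    · rw [hjoin]
      exact hconn x y
  | find pc =>
    obtain ⟨pc', rfl, hstep⟩ := Local.step_find hs
    have hroot : ∀ x, c.mem.P x = x → m'.P x = x := by
      have hI' := h.inv.locals t _ hp
      have hO := h.obligations_of_find hp
      rw [hO] at hI'
      exact (findStep_safe h.inv.good (O := ∅) (fun _ _ _ h => h.elim)
        (fun _ _ _ _ h => h.elim) hI' hstep).2.2.2
    have hnounion : ∀ t' x y pc₁, c.thread t' ≠ some (.union x y pc₁) :=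
      fun t' x y pc₁ ht' => h.phase _ _ _ _ _ _ ht' hp
    have hnounion' : ∀ t' x y pc₁, Function.update c.thread t (some (.find pc')) t' ≠
        some (.union x y pc₁) := by
      intro t' x y pc₁
      by_cases hne : t' = t
      · subst hne
        simp
      · simpa [hne] using hnounion t' x y pc₁
    have hjoin : Joined s ⟨m', Function.update c.thread t (some (.find pc'))⟩ = Joined s c := by
      funext x y
      simp [Joined, hnounion, hnounion']
    refine ⟨hI, fun t' ht' => ?_, fun t' u' v' pc₁ ht' => (hnounion' _ _ _ _ ht').elim,
      fun t' pc₁ ht' => ?_, fun t₁ t₂ u' v' pc₁ pc₂ h₁ _ => hnounion' _ _ _ _ h₁,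
      fun x y => ?_, h.label_idem, h.label_mem, h.label_le⟩
    · by_cases hne : t' = t
      · subst hne
        simp at ht'
      · simp only [Function.update_of_ne hne] at ht'
        exact h.idle t' ht'
    · by_cases hne : t' = t
      · subst hne
        simp only [Function.update_self, Option.some.injEq, Local.find.injEq] at ht'
        subst ht'
        obtain ⟨u, hu, htr⟩ := h.find _ _ hp
        refine ⟨u, hu, htr.step (fun x hx => ?_) hroot hstep⟩
        exact (h.joined_of_find hp (h.conn_parent x)).symm.trans hx
      · simp only [Function.update_of_ne hne] at ht'
        obtain ⟨u, hu, htr⟩ := h.find _ _ ht'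
        exact ⟨u, hu, htr.of_roots hroot⟩
    · rw [hjoin]
      exact hconn x y

/-- A returned union has no obligation, so the concrete side does not change. On the abstract side,
merging the labels replaces the pair that disappears, with the same generated equivalence. -/
theorem respond_union [DecidableEq ι] (h : Simulates A R lev c s st) {u v : Fin n} {b : Bool}
    (ht : c.thread t = some (.union u v (.ret b))) :
    Simulates A R lev ⟨c.mem, Function.update c.thread t none⟩ (mergeLabels s u v)
      (Function.update st t .idle) := by
  obtain ⟨hI, hO⟩ := h.inv.respond ht rfl
  have hnofind : ∀ t' pc, Function.update c.thread t none t' ≠ some (.find pc) := by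
    intro t' pc₁ ht'
    by_cases hne : t' = t
    · subst hne
      simp at ht'
    · simp only [Function.update_of_ne hne] at ht'
      exact h.phase _ _ _ _ _ _ ht ht'
  have hmin : min (s u) (s v) = s u ∨ min (s u) (s v) = s v := min_choice _ _
  have hmerge : ∀ x, ((s x = s u ∨ s x = s v) ∧ mergeLabels s u v x = min (s u) (s v)) ∨
      (¬ (s x = s u ∨ s x = s v) ∧ mergeLabels s u v x = s x) := by
    intro x
    unfold mergeLabels
    split_ifs with hx
    · exact .inl ⟨hx, rfl⟩
    · exact .inr ⟨hx, rfl⟩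
  have hcongr : ∀ {x y}, s x = s y → mergeLabels s u v x = mergeLabels s u v y := by
    intro x y hxy
    unfold mergeLabels
    rw [hxy]
  have huv : mergeLabels s u v u = mergeLabels s u v v := by simp [mergeLabels]
  have hself : ∀ x, Relation.EqvGen (Joined s c) x (s x) :=
    fun x => .rel _ _ (.inl (h.label_idem x).symm)
  have huv' : Relation.EqvGen (Joined s c) (s u) (s v) :=
    .trans _ _ _ (.symm _ _ (hself u)) (.trans _ _ _ (.rel _ _ (.inr ⟨t, _, ht⟩)) (hself v))
  have hlabel : ∀ x, Relation.EqvGen (Joined s c) x (mergeLabels s u v x) := by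
    intro x
    rcases hmerge x with ⟨hx, hm⟩ | ⟨-, hm⟩
    · rw [hm]
      refine .trans _ _ _ (hself x) ?_
      rcases hx with hx | hx <;> rcases hmin with hm | hm <;> rw [hx, hm]
      · exact .refl _
      · exact huv'
      · exact .symm _ _ huv'
      · exact .refl _
    · rw [hm]
      exact hself x
  refine ⟨hI, fun t' ht' => ?_, fun t' u' v' pc₁ ht' => ?_, fun t' pc₁ ht' => ?_,
    fun t₁ t₂ u' v' pc₁ pc₂ _ h₂ => hnofind _ _ h₂, fun x y => ?_, fun x => ?_, fun x => ?_,
    fun x hx => ?_⟩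
  · by_cases hne : t' = t
    · subst hne
      simp
    · simp only [Function.update_of_ne hne] at ht' ⊢
      exact h.idle t' ht'
  · by_cases hne : t' = t
    · subst hne
      simp at ht'
    · simp only [Function.update_of_ne hne] at ht' ⊢
      exact h.union _ _ _ _ ht'
  · exact (hnofind _ _ ht').elim
  · rw [hO, h.conn x y]
    constructor
    · refine eqvGen_le (Relation.EqvGen.is_equivalence _) ?_
      rintro x y (hs | ⟨t', pc, ht'⟩)
      · exact .rel _ _ (.inl (hcongr hs))
      · by_cases hne : t' = t
        · subst hne
          rw [ht] at ht'
          obtain ⟨⟩ := ht'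
          exact .rel _ _ (.inl huv)
        · exact .rel _ _ (.inr ⟨t', pc, by simpa [hne] using ht'⟩)
    · refine eqvGen_le (Relation.EqvGen.is_equivalence _) ?_
      rintro x y (hs | ⟨t', pc, ht'⟩)
      · refine .trans _ _ _ (hlabel x) ?_
        rw [hs]
        exact .symm _ _ (hlabel y)
      · by_cases hne : t' = t
        · subst hne
          simp at ht'
        · exact .rel _ _ (.inr ⟨t', pc, by simpa [hne] using ht'⟩)
  · rcases hmerge x with ⟨hx, hm⟩ | ⟨hx, hm⟩
    · rw [hm]
      rcases hmin with hm' | hm' <;> rw [hm', hcongr (h.label_idem _), ← hm'] <;>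
        simp [mergeLabels]
    · rw [hm, hcongr (h.label_idem x), hm]
  · rcases hmerge x with ⟨-, hm⟩ | ⟨-, hm⟩
    · rw [hm]
      rcases hmin with hm' | hm' <;> rw [hm'] <;> exact h.label_mem _
    · rw [hm]
      exact h.label_mem x
  · have hle := h.label_le x hx
    rcases hmerge x with ⟨hx | hx, hm⟩ | ⟨-, hm⟩
    · rw [hm]
      exact (min_le_left _ _).trans (hx ▸ hle)
    · rw [hm]
      exact (min_le_right _ _).trans (hx ▸ hle)
    · rwa [hm]

/-- Without obligations connectivity is equality of roots, so `r` is the root of its own label `s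
r`. This gives `r ≤ s r`, while `label_le` gives `s r ≤ r`; and `s r = s u` by `FindTrack`. -/
theorem respond_find [DecidableEq ι] (h : Simulates A R lev c s st) {r : Fin n}
    (ht : c.thread t = some (.find (.ret r))) :
    Simulates A R lev ⟨c.mem, Function.update c.thread t none⟩ s
      (Function.update st t .idle) ∧ ∃ u, st t = .pending (.find u) ∧ r = s u := by
  obtain ⟨hI, hO⟩ := h.inv.respond ht rfl
  have hthread : ∀ {t' p}, Function.update c.thread t none t' = some p →
      t' ≠ t ∧ c.thread t' = some p := by
    intro t' p ht'
    by_cases hne : t' = t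
    · subst hne
      simp at ht'
    · exact ⟨hne, by simpa [hne] using ht'⟩
  have hjoin : Joined s ⟨c.mem, Function.update c.thread t none⟩ = Joined s c := by
    funext x y
    refine propext (or_congr_right ⟨?_, ?_⟩)
    · rintro ⟨t', pc, ht'⟩
      exact ⟨t', pc, (hthread ht').2⟩
    · rintro ⟨t', pc, ht'⟩
      exact (h.phase _ _ _ _ _ _ ht' ht).elim
  refine ⟨⟨hI, fun t' ht' => ?_, fun t' u' v' pc₁ ht' => ?_, fun t' pc₁ ht' => ?_,
    fun t₁ t₂ u' v' pc₁ pc₂ h₁ h₂ => h.phase _ _ _ _ _ _ (hthread h₁).2 (hthread h₂).2,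
    fun x y => ?_, h.label_idem, h.label_mem, h.label_le⟩, ?_⟩
  · by_cases hne : t' = t
    · subst hne
      simp
    · simp only [Function.update_of_ne hne] at ht' ⊢
      exact h.idle t' ht'
  · rw [Function.update_of_ne (hthread ht').1]
    exact h.union _ _ _ _ (hthread ht').2
  · rw [Function.update_of_ne (hthread ht').1]
    exact h.find _ _ (hthread ht').2
  · rw [hO, hjoin]
    exact h.conn x y
  · obtain ⟨u, hu, hr, hroot⟩ := h.find _ _ ht
    refine ⟨u, hu, ?_⟩
    have hG := h.inv.good
    have hc : Conn R c.mem.P (c.obligations lev) (n + 1) (s r) r :=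
      (h.conn _ _).2 (.rel _ _ (.inl (h.label_idem r)))
    rw [h.obligations_of_find ht] at hc
    have h1 := hc.root_eq hG (fun _ _ _ h => h.elim)
    rw [Good.root_of_fixed hroot] at h1
    have h2 := hG.root_le (h.label_mem r)
    rw [h1] at h2
    rw [← hr]
    exact le_antisymm h2 (h.label_le r (hG.mem_of_root hroot))

end Simulates

/-- Each operation is linearized immediately before its response; unions still pending are never
applied, as `Joined` accounts for their partial effects. -/
theorem PhaseExec.simulates [DecidableEq ι] {C₀ : Fin n → Fin n} (hC₀ : ∀ v, C₀ (C₀ v) = C₀ v)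
    {H : List (Event ι (Op n) (Res n))} (hH : PhaseExec A (idleConfig ι C₀) H c) :
    ∃ s st lev, AtomicExec seqUnionFind C₀ H s st ∧
      Simulates A (fun x => C₀ x = x) lev c s st := by
  induction hH with
  | nil => exact ⟨_, _, _, .nil, .initial hC₀⟩
  | invoke t o _ ht hphase ih =>
    obtain ⟨s, st, lev, hA, hS⟩ := ih
    refine ⟨s, _, Function.update lev t (n + 1), hA.invoke t o (hS.idle t ht), ?_⟩
    cases o with
    | union u v => exact hS.invoke_union ht u v hphase
    | find u => exact hS.invoke_find ht u hphase
  | internal _ hs ih =>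
    obtain ⟨s, st, lev, hA, hS⟩ := ih
    obtain ⟨lev', hS'⟩ := hS.internalStep hs
    exact ⟨s, st, lev', hA, hS'⟩
  | respond t p r _ ht hr ih =>
    obtain ⟨s, st, lev, hA, hS⟩ := ih
    have hupdate : ∀ a : Status (Op n) (Res n), Function.update st t .idle =
        Function.update (Function.update st t a) t .idle := fun a => by simp
    obtain ⟨-, -, ⟨u, v, b, rfl, rfl⟩ | ⟨x, rfl, rfl⟩⟩ := Local.of_result (l := 0) hr
    · refine ⟨_, _, lev, ?_, hS.respond_union ht⟩
      rw [hupdate (.applied (.union b))]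
      have hδ : seqUnionFind s (.union u v) (.union b) (mergeLabels s u v) := fun _ => rfl
      exact (hA.linearize t _ _ (hS.union _ _ _ _ ht) hδ).respond t _ (by simp)
    · obtain ⟨hS', u, hu, hx⟩ := hS.respond_find ht
      refine ⟨_, _, lev, ?_, hS'⟩
      rw [hupdate (.applied (.find x))]
      have hδ : seqUnionFind s (.find u) (.find x) s := ⟨hx, rfl⟩
      exact (hA.linearize t _ _ hu hδ).respond t _ (by simp)

end Config

/-! ### Connectivity -/

section Connectivity

variable {n : ℕ} {A : Variant} {G : SimpleGraph (Fin n)} {C₀ : Fin n → Fin n}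
  {Lmax : Option (Fin n)}

instance : Finite (ProcessedEdge G C₀ Lmax) :=
  inferInstanceAs (Finite {e : Fin n × Fin n // G.Adj e.1 e.2 ∧ some (C₀ e.1) ≠ Lmax})

theorem inv_connectivityStart (hC₀ : ∀ v, C₀ (C₀ v) = C₀ v) :
    Inv A (fun x => C₀ x = x) (fun _ => n + 1) (connectivityStart A G C₀ Lmax) :=
  .initial hC₀ rfl fun e _ he => ⟨.union e.1.1 e.1.2, (Option.some.inj he).symm⟩

theorem conn_connectivityStart (hC₀ : ∀ v, C₀ (C₀ v) = C₀ v)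
    (hG : ∀ u v, C₀ u = C₀ v → G.Reachable u v) (x y : Fin n) :
    Conn (fun x => C₀ x = x) C₀ ((connectivityStart A G C₀ Lmax).obligations fun _ => n + 1)
      (n + 1) x y ↔ G.Reachable x y := by
  have hself : ∀ x, G.Reachable x (C₀ x) := fun x => hG _ _ (hC₀ x).symm
  constructor
  · refine eqvGen_le G.reachable_is_equivalence ?_
    rintro _ _ (⟨_, -⟩ | ⟨a, b, l, ⟨⟨⟨u, v⟩, he, _⟩, hm⟩, -⟩)
    · exact hself _
    · obtain ⟨⟩ := hm
      exact (hself u).symm.trans (he.reachable.trans (hself v))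
  · have hparent : ∀ x, Conn (fun x => C₀ x = x) C₀
        ((connectivityStart A G C₀ Lmax).obligations fun _ => n + 1) (n + 1) x (C₀ x) :=
      fun x => Conn.parent (rank_le.trans (Nat.le_succ n))
    have hedge : ∀ u v, G.Adj u v → some (C₀ u) ≠ Lmax → Conn (fun x => C₀ x = x) C₀
        ((connectivityStart A G C₀ Lmax).obligations fun _ => n + 1) (n + 1) u v := by
      intro u v ha hu
      exact (hparent u).trans (.trans (.pair (l := n + 1) ⟨⟨(u, v), ha, hu⟩, rfl⟩ le_rfl)
        (hparent v).symm)
    intro h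
    rw [SimpleGraph.reachable_iff_reflTransGen] at h
    induction h with
    | refl => exact Conn.refl _
    | @tail u v _ ha ih =>
      refine ih.trans ?_
      by_cases hu : some (C₀ u) = Lmax
      -- A skipped edge is processed in the opposite direction, unless both ends have label `Lmax`;
      -- then their equal labels already join them.
      · by_cases hv : some (C₀ v) = Lmax
        · have : C₀ u = C₀ v := Option.some.inj (hu.trans hv.symm)
          exact (hparent u).trans (this ▸ (hparent v).symm)
        · exact (hedge v u ha.symm hv).symm
      · exact hedge u v ha hu

/-- Operations that have returned carry no obligation, so pointers alone generate the connectivity.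
-/
theorem Inv.finished {ι : Type*} {R : Fin n → Prop} {lev : ι → ℕ} {c : Config ι n}
    (h : Inv A R lev c) (hc : c.Finished) (x y : Fin n) :
    c.mem.P^[n] x = c.mem.P^[n] y ↔ Conn R c.mem.P (c.obligations lev) (n + 1) x y := by
  constructor
  · intro hxy
    have key : ∀ x, Conn R c.mem.P (c.obligations lev) (n + 1) x (c.mem.P^[n] x) :=
      fun x => (Conn.root h.good).mono (rank_le.trans (Nat.le_succ n))
    exact (key x).trans (hxy ▸ (key y).symm)
  · refine fun hxy => hxy.root_eq h.good ?_
    rintro a b l ⟨t, hm⟩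
    cases hp : c.thread t with
    | none => rw [hp] at hm; cases hm
    | some p =>
      obtain ⟨r, hr⟩ := hc t p hp
      rw [hp] at hm
      simp only [threadObligation, (Local.of_result hr).1] at hm
      cases hm

end Connectivity

end RemUF

theorem mainTheorem4 (A : RemUF.Variant) (n : ℕ) (C₀ : Fin n → Fin n)
    (hC₀ : ∀ v, C₀ (C₀ v) = C₀ v) :
    (∀ (G : SimpleGraph (Fin n)) (Lmax : Option (Fin n)),
      (∀ u v, C₀ u = C₀ v → G.Reachable u v) →
        RemUF.Terminates A (RemUF.connectivityStart A G C₀ Lmax) ∧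
        ∀ c, Relation.ReflTransGen (RemUF.InternalStep A)
            (RemUF.connectivityStart A G C₀ Lmax) c → c.Finished →
          ∃ C : Fin n → Fin n, (∀ v, RemUF.IsRootOf c.mem.P v (C v)) ∧
            RemUF.IsConnectivityLabeling G C) ∧
    (∀ (ι : Type*) [Finite ι] [DecidableEq ι]
      (H : List (RemUF.Event ι (RemUF.Op n) (RemUF.Res n))) (c : RemUF.Config ι n),
      RemUF.PhaseExec A (RemUF.idleConfig ι C₀) H c →
        RemUF.Linearizable RemUF.seqUnionFind C₀ H ∧ RemUF.Terminates A c) := by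
  refine ⟨fun G Lmax hG => ⟨(RemUF.inv_connectivityStart hC₀).terminates, fun c hc hfin => ?_⟩,
    fun ι _ _ H c hH => ?_⟩
  · obtain ⟨lev, hI, hP⟩ := (RemUF.inv_connectivityStart hC₀).steps hc
    refine ⟨fun v => c.mem.P^[n] v, fun v => ⟨hI.good.root_fixed, n, rfl⟩, fun u v => ?_⟩
    rw [hI.finished hfin, ← RemUF.conn_connectivityStart (A := A) (Lmax := Lmax) hC₀ hG]
    exact ⟨hP.back u v, hP.conn _ u v⟩
  · obtain ⟨s, st, lev, hA, hS⟩ := hH.simulates hC₀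
    exact ⟨⟨s, st, hA⟩, hS.inv.terminates⟩
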